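/- A mixed graph $M$ is obtained from a finite simple graph by orienting some of its edges. Its Hermitian adjacency matrix $H(M)=(h_{uv})$ has $h_{uv}=\mathbf i$ if $u\to v$ is an arc, $h_{uv}=-\mathbf i$ if $v\to u$ is an arc, $h_{uv}=1$ if $\{u,v\}$ is an undirected edge, and $h_{uv}=0$ otherwise; the spectral radius $\rho(M)$ is the largest absolute value of an eigenvalue of $H(M)$. A mixed graph is connected if its underlying graph is. A mixed cycle of $M$ is a subgraph of $M$ whose underlying graph is a cycle. A four-way switching replaces $M$ by a mixed graph $M'$ with $H(M)=D^{-1}H(M')D$ for some diagonal matrix $D$ with diagonal entries in $\{\pm1,\pm\mathbf i\}$. Two mixed graphs are switching isomorphic if one is obtained from the other by four-way switchings and vertex relabellings, possibly followed by reversing all arcs. Let $C_4''$ be the mixed $4$-cycle $v_1v_2v_3v_4v_1$ whose arcs are $v_1\to v_2$ and $v_2\to v_3$, the other two edges being undirected. A mixed graph is $C_4''$-free if no mixed graph switching isomorphic to $C_4''$ is a (not necessarily induced) subgraph of it; equivalently, if it contains no negative $4$-cycle. Let $M^\ast$ be the mixed graph on $10$ vertices obtained from $K_4$ with vertices $0,1,2,3$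 by replacing every edge $ab$ with $a<b$ by a directed path $a\to s_{ab}\to b$ through a new vertex $s_{ab}$. Proposition. $\rho(M^\ast)=2$. Moreover, if $M$ is a connected $C_4''$-free mixed graph with at least two mixed cycles, then $\rho(M)>\sqrt{2+\sqrt5}$ unless $M$ is switching isomorphic to an induced subgraph of $M^\ast$, and in that exceptional case $\rho(M)\le\sqrt{2+\sqrt5}$. -/

import Mathlib

/-- A mixed graph on the vertex set `V`: a simple graph some of whose edges are oriented.
`Arc u v` says that the edge `uv` is oriented from `u` to `v`; an edge without an arc in either
direction is undirected. -/
structure MixedGraph (V : Type*) where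
  /-- the underlying simple graph -/
  graph : SimpleGraph V
  /-- the arcs -/
  Arc : V → V → Prop
  adj_of_arc : ∀ {u v : V}, Arc u v → graph.Adj u v
  arc_asymm : ∀ {u v : V}, Arc u v → ¬ Arc v u

namespace MixedGraph

/-- The mixed graph obtained by reversing all arcs. -/
def converse {V : Type*} (M : MixedGraph V) : MixedGraph V where
  graph := M.graph
  Arc u v := M.Arc v u
  adj_of_arc h := (M.adj_of_arc h).symm
  arc_asymm h := M.arc_asymm h

/-- Relabelling the vertices along a bijection `σ : V ≃ W`. -/
def relabel {V W : Type*} (N : MixedGraph W) (σ : V ≃ W) : MixedGraph V where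
  graph := N.graph.comap σ
  Arc u v := N.Arc (σ u) (σ v)
  adj_of_arc h := N.adj_of_arc h
  arc_asymm h := N.arc_asymm h

open Classical in
/-- The Hermitian adjacency matrix. -/
noncomputable def hMatrix {V : Type*} (M : MixedGraph V) : Matrix V V ℂ :=
  Matrix.of fun u v =>
    if M.Arc u v then Complex.I
    else if M.Arc v u then -Complex.I
    else if M.graph.Adj u v then 1
    else 0

theorem hMatrix_isHermitian {V : Type*} (M : MixedGraph V) : M.hMatrix.IsHermitian := by
  ext u v
  have h1 : M.Arc u v → ¬ M.Arc v u := fun h => M.arc_asymm h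
  have h2 := M.graph.adj_comm u v
  by_cases a : M.Arc u v <;> by_cases b : M.Arc v u <;> by_cases c : M.graph.Adj u v <;>
    simp_all [hMatrix, Matrix.conjTranspose_apply]

/-- The spectral radius: the largest absolute value of an eigenvalue of the Hermitian adjacency
matrix. -/
noncomputable def spectralRadius {V : Type*} [Fintype V] [DecidableEq V] (M : MixedGraph V) : ℝ :=
  ⨆ v : V, |M.hMatrix_isHermitian.eigenvalues v|

/-- `M` and `M'` (on the same vertex set) differ by a four-way switching:
`H(M) = D⁻¹ H(M') D` for a diagonal matrix `D` with diagonal entries in `{1, -1, i, -i}`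
(written entry by entry). -/
def FourWaySwitching {V : Type*} (M M' : MixedGraph V) : Prop :=
  ∃ d : V → ℂ, (∀ v, d v ∈ ({1, -1, Complex.I, -Complex.I} : Set ℂ)) ∧
    ∀ u v, M.hMatrix u v = (d u)⁻¹ * M'.hMatrix u v * d v

/-- Switching isomorphism: four-way switching and relabelling of the vertices, possibly followed
by taking the converse. (A composition of several switchings and relabellings is one relabelling
together with one switching.) -/
def SwitchingIsomorphic {V W : Type*} (M : MixedGraph V) (N : MixedGraph W) : Prop :=
  ∃ σ : V ≃ W, FourWaySwitching M (N.relabel σ) ∨ FourWaySwitching M (N.converse.relabel σ)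

/-- `M'` is (isomorphic to) a subgraph of `M`, not necessarily induced, arcs keeping their
direction. -/
def IsSubgraphOf {V W : Type*} (M' : MixedGraph V) (M : MixedGraph W) : Prop :=
  ∃ f : V ↪ W, ∀ u v, M'.graph.Adj u v →
    M.graph.Adj (f u) (f v) ∧ (M'.Arc u v ↔ M.Arc (f u) (f v))

/-- `M'` is (isomorphic to) an induced subgraph of `M`, arcs keeping their direction. -/
def IsInducedSubgraphOf {V W : Type*} (M' : MixedGraph V) (M : MixedGraph W) : Prop :=
  ∃ f : V ↪ W, ∀ u v,
    (M'.graph.Adj u v ↔ M.graph.Adj (f u) (f v)) ∧ (M'.Arc u v ↔ M.Arc (f u) (f v))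

/-- `M'` is an induced subgraph of `M` up to switching isomorphism. -/
def IsSwitchingInduced {V W : Type*} (M' : MixedGraph V) (M : MixedGraph W) : Prop :=
  ∃ N : MixedGraph V, SwitchingIsomorphic M' N ∧ N.IsInducedSubgraphOf M

/-- `M` is `F`-free: no mixed graph switching isomorphic to `F` is a (not necessarily induced)
subgraph of `M`. -/
def IsFree {V W : Type*} (F : MixedGraph V) (M : MixedGraph W) : Prop :=
  ∀ N : MixedGraph V, SwitchingIsomorphic N F → ¬ N.IsSubgraphOf M

/-- `M` contains at least two (distinct) mixed cycles, a cycle being a subgraph. -/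
def HasTwoCycles {V : Type*} (M : MixedGraph V) : Prop :=
  ∃ (u v : V) (p : M.graph.Walk u u) (q : M.graph.Walk v v),
    p.IsCycle ∧ q.IsCycle ∧ p.toSubgraph ≠ q.toSubgraph

/-- The mixed `4`-cycle `0, 1, 2, 3` whose arcs are `0 → 1` and `1 → 2`, the edges `23` and `30`
being undirected. -/
def negFourCycle : MixedGraph (Fin 4) where
  graph := SimpleGraph.cycleGraph 4
  Arc u v := (u, v) ∈ ({(0, 1), (1, 2)} : Finset (Fin 4 × Fin 4))
  adj_of_arc {u v} := by revert u v; decide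
  arc_asymm {u v} := by revert u v; decide

/-- The arcs of `mStar`. -/
def mStarArcs : Finset (Fin 10 × Fin 10) :=
  {(0, 4), (4, 1), (0, 5), (5, 2), (0, 6), (6, 3), (1, 7), (7, 2), (1, 8), (8, 3), (2, 9), (9, 3)}

/-- The mixed graph `M*`: the complete graph on `0, 1, 2, 3` with every edge `ab` (`a < b`)
subdivided by one new vertex `s`, the two halves being arcs `a → s → b`. All its `6`-cycles are
negative. -/
def mStar : MixedGraph (Fin 10) where
  graph := SimpleGraph.fromRel fun u v => (u, v) ∈ mStarArcs
  Arc u v := (u, v) ∈ mStarArcs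
  adj_of_arc {u v} := by
    rw [SimpleGraph.fromRel_adj]
    revert u v; decide
  arc_asymm {u v} := by revert u v; decide

end MixedGraph

/-!
Write `T = √(2 + √5)` and let `H` be the Hermitian adjacency matrix.

If `M` is an induced subgraph of `mStar` up to switching isomorphism, interlacing
(`IsSwitchingInduced.spectralRadius_le`) gives `ρ(M) ≤ ρ(mStar) = 2 < T`; the value `2` comes from
writing `4 - H(mStar) ^ 2` as a sum of squares (`normSq_mStar_mulVec_le`).

Conversely, let `ρ(M) ≤ T`. The bipartite double of `M` has the same spectral radius and no negative
`4`-cycle either, so it suffices to study bipartite graphs (`AdmissibleGain`). There the positive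
semidefiniteness of `T ^ 2 - H ^ 2` is used on small sets of vertices of one colour, on which the
entries of `H ^ 2` are degrees and sums over common neighbours; since no `4`-cycle is negative, the
terms of such a sum never cancel (`one_le_normSq`, `two_le_normSq`).

The `2`-core of `M` has a vertex `v` with three neighbours in the core, because `M` is connected
and has two cycles (`Connected.exists_branch`). The inequalities on `H ^ 2` force the ball of radius
`2` around `v` to be a subdivided claw with ends `x`, `y`, `z` (`exists_isHub`). Two ends have at
most one common neighbour, which closes a hexagon through `v`. Some hexagon is negative, otherwise
the principal submatrix of `H ^ 2` on `v`, `x`, `y`, `z` has an eigenvalue above `T ^ 2`; an end of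
degree `3` is on negative hexagons with both other ends; no hexagon has weight `1`.

The one argument that is not local is `hexWeight_ne_neg_one`: the two ends on a negative hexagon do
not both have degree `2`. A negative hexagon with a tail of any length has spectral radius below
`T`, but in the limit of infinite length `T` is attained. With `t ^ 4 = t ^ 2 + 1` and
`T = t ^ 3 = t + t⁻¹`, the vector that decays by the factor `t` along the tail solves the eigenvalue
equation up to a defect at the last vertex. Following the tail within the core, the next vertex
always has degree `2`, as a branching would exceed the bound (`IsTailVector.card_le_two`), so the
tail never ends, in a finite graph.

Hence some end, say `x`, has degree `3` and is on negative hexagons with `y` and `z`. Then `x` is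
itself a branch vertex, and the component of `v` is either `mStar` or `mStar` with one subdivision
vertex deleted (`exists_isMStarCopy`). Its colour classes have different sizes, so `M` is bipartite
and isomorphic to this component (`isSwitchingInduced_of_isMStarCopy`).
-/

open Matrix Finset

/-! ### Gaussian units and the matrices under study -/


/-- The fourth roots of unity in `ℂ`. -/
def IsGaussUnit (z : ℂ) : Prop := z = 1 ∨ z = -1 ∨ z = Complex.I ∨ z = -Complex.I

namespace IsGaussUnit

theorem mul {z w : ℂ} (hz : IsGaussUnit z) (hw : IsGaussUnit w) : IsGaussUnit (z * w) := by
  rcases hz with rfl | rfl | rfl | rfl <;> rcases hw with rfl | rfl | rfl | rfl <;>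
    simp [IsGaussUnit]

theorem star {z : ℂ} (hz : IsGaussUnit z) : IsGaussUnit (starRingEnd ℂ z) := by
  rcases hz with rfl | rfl | rfl | rfl <;> simp [IsGaussUnit]

theorem mul_conj {z : ℂ} (hz : IsGaussUnit z) : z * starRingEnd ℂ z = 1 := by
  rcases hz with rfl | rfl | rfl | rfl <;> simp

theorem conj_mul {z : ℂ} (hz : IsGaussUnit z) : starRingEnd ℂ z * z = 1 := by
  rw [mul_comm, hz.mul_conj]

theorem normSq {z : ℂ} (hz : IsGaussUnit z) : Complex.normSq z = 1 := by
  rcases hz with rfl | rfl | rfl | rfl <;> simp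

theorem ne_zero {z : ℂ} (hz : IsGaussUnit z) : z ≠ 0 := by
  rcases hz with rfl | rfl | rfl | rfl <;> simp

theorem re_nonneg {z : ℂ} (hz : IsGaussUnit z) (h : z ≠ -1) : 0 ≤ z.re := by
  rcases hz with rfl | rfl | rfl | rfl <;> simp_all

end IsGaussUnit

/-- The Hermitian adjacency matrix `H` of a mixed graph with bipartition `col` that has no negative
`4`-cycle and whose spectral radius is at most `√(2 + √5)`. Adjacency is `H u v ≠ 0`; the weight of
a `4`-cycle is excluded from being `-1`, while `1`, `i` and `-i` are allowed; the bound on the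
spectral radius is stated as `‖H f‖ ^ 2 ≤ (2 + √5) ‖f‖ ^ 2`. -/
structure AdmissibleGain {W : Type*} [Fintype W] (H : Matrix W W ℂ) (col : W → Bool) : Prop where
  conj_apply : ∀ u v, starRingEnd ℂ (H u v) = H v u
  isGaussUnit : ∀ {u v}, H u v ≠ 0 → IsGaussUnit (H u v)
  col_ne : ∀ {u v}, H u v ≠ 0 → col u ≠ col v
  four_cycle_ne : ∀ {u u' w w'}, u ≠ u' → w ≠ w' → H u w * H w u' * H u' w' * H w' u ≠ -1
  norm_le : ∀ f : W → ℂ, ∑ u, Complex.normSq ((H *ᵥ f) u) ≤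
    (2 + √5) * ∑ u, Complex.normSq (f u)

/-- The neighbours of `u` in the graph of the nonzero entries of `H`. -/
noncomputable def gainNbrs {W : Type*} [Fintype W] (H : Matrix W W ℂ) (u : W) : Finset W :=
  univ.filter fun w => H u w ≠ 0

theorem mem_gainNbrs {W : Type*} [Fintype W] {H : Matrix W W ℂ} {u w : W} :
    w ∈ gainNbrs H u ↔ H u w ≠ 0 := by
  simp [gainNbrs]

theorem sqrt_five_bounds : 2.236 < √5 ∧ √5 < 2.2361 :=
  ⟨Real.lt_sqrt_of_sq_lt (by norm_num), (Real.sqrt_lt' (by norm_num)).2 (by norm_num)⟩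

namespace AdmissibleGain

variable {W : Type*} [Fintype W] {H : Matrix W W ℂ} {col : W → Bool}

theorem symm (hH : AdmissibleGain H col) {u v : W} (h : H u v ≠ 0) : H v u ≠ 0 := by
  rw [← hH.conj_apply]
  simpa using h

theorem ne (hH : AdmissibleGain H col) {u v : W} (h : H u v ≠ 0) : u ≠ v := by
  rintro rfl
  exact hH.col_ne h rfl

theorem mul_symm (hH : AdmissibleGain H col) {u v : W} (h : H u v ≠ 0) : H u v * H v u = 1 := by
  rw [← hH.conj_apply u v, (hH.isGaussUnit h).mul_conj]

theorem conj_sq_apply (hH : AdmissibleGain H col) (u v : W) :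
    starRingEnd ℂ ((H * H) u v) = (H * H) v u := by
  simp only [Matrix.mul_apply, map_sum, map_mul, hH.conj_apply]
  exact sum_congr rfl fun w _ => mul_comm _ _

theorem sq_apply_self (hH : AdmissibleGain H col) (u : W) :
    (H * H) u u = ((gainNbrs H u).card : ℂ) := by
  rw [Matrix.mul_apply, gainNbrs, card_filter]
  push_cast
  refine sum_congr rfl fun w _ => ?_
  split_ifs with h
  · exact hH.mul_symm h
  · simp [not_not.1 h]

/-- The principal submatrices of `H ^ 2` are bounded by `2 + √5`. -/
theorem gram_le (hH : AdmissibleGain H col) {n : ℕ} {u : Fin n → W} (hu : Function.Injective u)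
    (c : Fin n → ℂ) :
    (∑ i, ∑ j, starRingEnd ℂ (c i) * c j * (H * H) (u i) (u j)).re ≤
      (2 + √5) * ∑ i, Complex.normSq (c i) := by
  classical
  have key := hH.norm_le fun w => ∑ i, if u i = w then c i else 0
  have h1 : ∑ w, Complex.normSq (∑ i, if u i = w then c i else 0) =
      ∑ i, Complex.normSq (c i) := by
    rw [← sum_subset (subset_univ (univ.image u)), sum_image fun i _ j _ h => hu h]
    · refine sum_congr rfl fun j _ => ?_
      rw [sum_eq_single j] <;> simp +contextual [hu.eq_iff]
    · intro w _ hw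
      rw [sum_eq_zero, map_zero]
      intro i _
      rw [if_neg]
      rintro rfl
      exact hw (mem_image_of_mem _ (mem_univ _))
  have h2 : ∀ w, (H *ᵥ fun w => ∑ i, if u i = w then c i else 0) w = ∑ i, H w (u i) * c i := by
    intro w
    simp only [Matrix.mulVec, dotProduct, mul_sum]
    rw [sum_comm]
    simp
  rw [h1] at key
  simp only [h2] at key
  refine le_trans (le_of_eq ?_) key
  have h3 : ∑ w, ((Complex.normSq (∑ i, H w (u i) * c i) : ℝ) : ℂ) =
      ∑ i, ∑ j, starRingEnd ℂ (c i) * c j * (H * H) (u i) (u j) := by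
    simp only [Complex.normSq_eq_conj_mul_self, map_sum, map_mul, hH.conj_apply,
      Matrix.mul_apply, sum_mul, mul_sum]
    rw [sum_congr rfl fun w _ => sum_comm, sum_comm]
    refine sum_congr rfl fun i _ => ?_
    rw [sum_comm]
    refine sum_congr rfl fun j _ => sum_congr rfl fun w _ => ?_
    ring
  rw [← h3, ← Complex.ofReal_sum, Complex.ofReal_re]

theorem term_self (hH : AdmissibleGain H col) {u u' w : W} (h : H u w ≠ 0) (h' : H w u' ≠ 0) :
    H u w * H w u' * (H u' w * H w u) = 1 := by
  rw [show H u w * H w u' * (H u' w * H w u) = (H u w * H w u) * (H w u' * H u' w) by ring,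
    hH.mul_symm h, hH.mul_symm h', one_mul]

/-- As there is no negative `4`-cycle, two common neighbours `w` and `v` of `u` and `u'` never
contribute opposite units to the entry of `H ^ 2` at `(u, u')`. -/
theorem re_term_nonneg (hH : AdmissibleGain H col) {u u' w : W} (hu : u ≠ u') (h : H u w ≠ 0)
    (h' : H w u' ≠ 0) (v : W) : 0 ≤ (H u v * H v u' * (H u' w * H w u)).re := by
  by_cases h2 : H u v * H v u' = 0
  · simp [h2]
  by_cases hv : v = w
  · subst hv
    simp [hH.term_self h h']
  have h3 := mul_ne_zero_iff.1 h2
  refine IsGaussUnit.re_nonneg ?_ ?_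
  · exact ((hH.isGaussUnit h3.1).mul (hH.isGaussUnit h3.2)).mul
      ((hH.isGaussUnit (hH.symm h')).mul (hH.isGaussUnit (hH.symm h)))
  · rw [← mul_assoc]
    exact hH.four_cycle_ne hu hv

theorem one_le_re (hH : AdmissibleGain H col) {u u' w : W} (hu : u ≠ u') (h : H u w ≠ 0)
    (h' : H w u' ≠ 0) : 1 ≤ ((H * H) u u' * (H u' w * H w u)).re := by
  rw [Matrix.mul_apply, sum_mul, Complex.re_sum, ← Complex.one_re, ← hH.term_self h h']
  exact single_le_sum (f := fun v => (H u v * H v u' * (H u' w * H w u)).re)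
    (fun v _ => hH.re_term_nonneg hu h h' v) (mem_univ w)

theorem one_le_normSq (hH : AdmissibleGain H col) {u u' w : W} (hu : u ≠ u') (h : H u w ≠ 0)
    (h' : H w u' ≠ 0) : 1 ≤ Complex.normSq ((H * H) u u') := by
  have h1 := hH.one_le_re hu h h'
  have h2 : Complex.normSq ((H * H) u u' * (H u' w * H w u)) = Complex.normSq ((H * H) u u') := by
    rw [map_mul, ((hH.isGaussUnit (hH.symm h')).mul (hH.isGaussUnit (hH.symm h))).normSq, mul_one]
  rw [← h2, Complex.normSq_apply]
  nlinarith [mul_self_nonneg ((H * H) u u' * (H u' w * H w u)).im]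

/-- Two contributions to an entry of `H ^ 2` are equal or perpendicular units; in both cases the
entry has absolute value at least `√2`. -/
theorem two_le_normSq (hH : AdmissibleGain H col) {u u' w w' : W} (hu : u ≠ u') (hw : w ≠ w')
    (h1 : H u w ≠ 0) (h2 : H w u' ≠ 0) (h3 : H u w' ≠ 0) (h4 : H w' u' ≠ 0) :
    2 ≤ Complex.normSq ((H * H) u u') := by
  have hne := hH.four_cycle_ne (u := u) (u' := u') hu hw
  have r1 := hH.one_le_re hu h1 h2
  have r2 := hH.one_le_re hu h3 h4
  have e : (H * H) u u' * (H u' w' * H w' u) =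
      (H * H) u u' * (H u' w * H w u) * (H u w * H w u' * H u' w' * H w' u) := by
    rw [show (H * H) u u' * (H u' w * H w u) * (H u w * H w u' * H u' w' * H w' u) =
      (H u w * H w u) * (H w u' * H u' w) * ((H * H) u u' * (H u' w' * H w' u)) by ring,
      hH.mul_symm h1, hH.mul_symm h2]
    ring
  have hs : Complex.normSq ((H * H) u u' * (H u' w * H w u)) = Complex.normSq ((H * H) u u') := by
    rw [map_mul, ((hH.isGaussUnit (hH.symm h2)).mul (hH.isGaussUnit (hH.symm h1))).normSq, mul_one]
  rw [← hs, Complex.normSq_apply]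
  set z := (H * H) u u' * (H u' w * H w u) with hz
  have hg : IsGaussUnit (H u w * H w u' * H u' w' * H w' u) :=
    (((hH.isGaussUnit h1).mul (hH.isGaussUnit h2)).mul (hH.isGaussUnit (hH.symm h4))).mul
      (hH.isGaussUnit (hH.symm h3))
  rw [e] at r2
  rcases hg with hg | hg | hg | hg
  · have : 2 ≤ z.re := by
      classical
      have h7 : ∑ v ∈ {w, w'}, (H u v * H v u' * (H u' w * H w u)).re ≤
          ∑ v, (H u v * H v u' * (H u' w * H w u)).re :=
        sum_le_sum_of_subset_of_nonneg (subset_univ _) fun v _ _ => hH.re_term_nonneg hu h1 h2 v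
      rw [hz, Matrix.mul_apply, sum_mul, Complex.re_sum]
      rw [sum_pair hw] at h7
      have h9 : H u w' * H w' u' * (H u' w * H w u) = 1 := by
        have := congrArg (starRingEnd ℂ) hg
        simp only [map_mul, hH.conj_apply, map_one] at this
        rw [← this]
        ring
      rw [hH.term_self h1 h2, h9] at h7
      norm_num at h7 ⊢
      linarith
    nlinarith [mul_self_nonneg z.im]
  · exact absurd hg hne
  · rw [hg] at r2
    simp only [Complex.mul_re, Complex.I_re, Complex.I_im] at r2
    nlinarith
  · rw [hg] at r2
    simp only [Complex.mul_re, Complex.neg_re, Complex.neg_im, Complex.I_re, Complex.I_im] at r2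
    nlinarith

/-- The neighbours of a vertex `w` span an all-ones block in `H ^ 2` up to switching, or more. -/
theorem star_le (hH : AdmissibleGain H col) {n : ℕ} {w : W} {u : Fin n → W}
    (hu : Function.Injective u) (hw : ∀ i, H w (u i) ≠ 0) {r : Fin n → ℝ} (hr : ∀ i, 0 ≤ r i) :
    ∑ i, ∑ j, r i * r j * (if i = j then ((gainNbrs H (u i)).card : ℝ) else 1) ≤
      (2 + √5) * ∑ i, r i ^ 2 := by
  have key := hH.gram_le hu fun i => r i * H (u i) w
  have hg : ∀ i, IsGaussUnit (H (u i) w) := fun i => hH.isGaussUnit (hH.symm (hw i))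
  have h1 : ∀ i, Complex.normSq (r i * H (u i) w) = r i ^ 2 := by
    intro i
    rw [map_mul, (hg i).normSq, Complex.normSq_ofReal]
    ring
  simp only [h1] at key
  refine le_trans ?_ key
  rw [Complex.re_sum]
  refine sum_le_sum fun i _ => ?_
  rw [Complex.re_sum]
  refine sum_le_sum fun j _ => ?_
  have h2 : starRingEnd ℂ (r i * H (u i) w) * (r j * H (u j) w) * (H * H) (u i) (u j) =
      ((r i * r j : ℝ) : ℂ) * ((H * H) (u i) (u j) * (H (u j) w * H w (u i))) := by
    rw [map_mul, Complex.conj_ofReal, hH.conj_apply]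
    push_cast
    ring
  rw [h2, Complex.re_ofReal_mul]
  refine mul_le_mul_of_nonneg_left ?_ (mul_nonneg (hr i) (hr j))
  split_ifs with hij
  · subst hij
    rw [hH.mul_symm (hH.symm (hw i)), mul_one, hH.sq_apply_self, Complex.natCast_re]
  · exact hH.one_le_re (fun h => hij (hu h)) (hH.symm (hw i)) (hw j)

end AdmissibleGain

/-! ### Forbidden degree patterns -/

namespace AdmissibleGain

variable {W : Type*} [Fintype W] {H : Matrix W W ℂ} {col : W → Bool}

theorem two_le_card {u a b : W} (hab : a ≠ b) (ha : H u a ≠ 0) (hb : H u b ≠ 0) :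
    2 ≤ (gainNbrs H u).card :=
  Finset.one_lt_card.2 ⟨a, mem_gainNbrs.2 ha, b, mem_gainNbrs.2 hb, hab⟩

theorem three_le_card {u a b c : W} (hab : a ≠ b) (hac : a ≠ c) (hbc : b ≠ c) (ha : H u a ≠ 0)
    (hb : H u b ≠ 0) (hc : H u c ≠ 0) : 3 ≤ (gainNbrs H u).card :=
  Finset.two_lt_card.2 ⟨a, mem_gainNbrs.2 ha, b, mem_gainNbrs.2 hb, c, mem_gainNbrs.2 hc,
    hab, hac, hbc⟩

theorem eq_or_eq_of_card_le {u a b : W} (hab : a ≠ b) (ha : H u a ≠ 0) (hb : H u b ≠ 0)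
    (hu : (gainNbrs H u).card ≤ 2) {w : W} (hw : H u w ≠ 0) : w = a ∨ w = b := by
  by_contra! h
  have := three_le_card hab h.1.symm h.2.symm ha hb hw
  omega

theorem eq_or_eq_or_eq_of_card_le {u a b c : W} (hab : a ≠ b) (hac : a ≠ c) (hbc : b ≠ c)
    (ha : H u a ≠ 0) (hb : H u b ≠ 0) (hc : H u c ≠ 0)
    (hu : (gainNbrs H u).card ≤ 3) {w : W} (hw : H u w ≠ 0) : w = a ∨ w = b ∨ w = c := by
  classical
  by_contra! h
  have h1 : ({a, b, c, w} : Finset W) ⊆ gainNbrs H u := by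
    intro y hy
    simp only [mem_insert, mem_singleton] at hy
    rw [mem_gainNbrs]
    rcases hy with rfl | rfl | rfl | rfl <;> assumption
  have h2 := card_le_card h1
  have h3 : ({a, b, c, w} : Finset W).card = 4 := by
    rw [card_insert_of_notMem, card_insert_of_notMem, card_pair h.2.2.symm] <;>
      simp [hab, hac, hbc, h.1.symm, h.2.1.symm]
  omega

/-- A vertex of degree `4` has no vertex at distance `2`: the subdivision of one edge of `K_{1,4}`
exceeds the bound. -/
theorem card_le_three (hH : AdmissibleGain H col) {u u' w : W} (hu : u ≠ u') (h : H u w ≠ 0)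
    (h' : H w u' ≠ 0) : (gainNbrs H u).card ≤ 3 := by
  by_contra! h4
  have h1 : 1 ≤ (gainNbrs H u').card := card_pos.2 ⟨w, mem_gainNbrs.2 (hH.symm h')⟩
  have hinj : Function.Injective ![u, u'] := by
    intro i j hij
    fin_cases i <;> fin_cases j <;> simp_all
  -- a test vector for the Gram matrix with rows `(4, 1)` and `(1, 1)`
  have key := hH.star_le (w := w) hinj (by intro i; fin_cases i <;> simp [h', hH.symm h])
    (r := ![1, 0.3]) (by intro i; fin_cases i <;> norm_num)
  simp [Fin.sum_univ_succ] at key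
  have h4' : (4 : ℝ) ≤ (gainNbrs H u).card := by exact_mod_cast h4
  have h1' : (1 : ℝ) ≤ (gainNbrs H u').card := by exact_mod_cast h1
  nlinarith [sqrt_five_bounds.2]

/-- Three neighbours of one vertex cannot have degrees at least `3`, `2` and `2`. -/
theorem star_three_two_two (hH : AdmissibleGain H col) {w n₁ n₂ n₃ : W} (h12 : n₁ ≠ n₂)
    (h13 : n₁ ≠ n₃) (h23 : n₂ ≠ n₃) (h1 : H w n₁ ≠ 0) (h2 : H w n₂ ≠ 0) (h3 : H w n₃ ≠ 0)
    (d1 : 3 ≤ (gainNbrs H n₁).card) (d2 : 2 ≤ (gainNbrs H n₂).card)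
    (d3 : 2 ≤ (gainNbrs H n₃).card) : False := by
  have hinj : Function.Injective ![n₁, n₂, n₃] := by
    intro i j hij
    fin_cases i <;> fin_cases j <;> simp_all
  -- `(√2, 1, 1)` is the Perron vector of the Gram matrix, with eigenvalue `3 + √2 > 2 + √5`
  have key := hH.star_le (w := w) hinj (by intro i; fin_cases i <;> simp [h1, h2, h3])
    (r := ![1.4, 1, 1]) (by intro i; fin_cases i <;> norm_num)
  simp [Fin.sum_univ_three] at key
  have d1' : (3 : ℝ) ≤ (gainNbrs H n₁).card := by exact_mod_cast d1
  have d2' : (2 : ℝ) ≤ (gainNbrs H n₂).card := by exact_mod_cast d2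
  have d3' : (2 : ℝ) ≤ (gainNbrs H n₃).card := by exact_mod_cast d3
  nlinarith [sqrt_five_bounds.2]

/-- Opposite vertices of a `4`-cycle do not both have degree at least `3`. -/
theorem card_lt_three_of_four_cycle (hH : AdmissibleGain H col) {u u' w w' : W} (hu : u ≠ u')
    (hw : w ≠ w') (h1 : H u w ≠ 0) (h2 : H w u' ≠ 0) (h3 : H u w' ≠ 0) (h4 : H w' u' ≠ 0)
    (hd : 3 ≤ (gainNbrs H u).card) : (gainNbrs H u').card < 3 := by
  by_contra! hd'
  have hk := hH.two_le_normSq hu hw h1 h2 h3 h4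
  have hinj : Function.Injective ![u, u'] := by
    intro i j hij
    fin_cases i <;> fin_cases j <;> simp_all
  -- the Perron vector, as `0.7 ≈ 1 / √2` and the off-diagonal entry has absolute value `√2`
  have key := hH.gram_le hinj ![1, ((0.7 : ℝ) : ℂ) * (H * H) u' u]
  have e : starRingEnd ℂ ((H * H) u' u) = (H * H) u u' := hH.conj_sq_apply _ _
  have e2 : (H * H) u' u * (H * H) u u' = (Complex.normSq ((H * H) u u') : ℂ) := by
    rw [Complex.normSq_eq_conj_mul_self, hH.conj_sq_apply]
  have e3 : Complex.normSq ((H * H) u' u) = Complex.normSq ((H * H) u u') := by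
    rw [← e, Complex.normSq_conj]
  simp only [Fin.sum_univ_two, Matrix.cons_val_zero, Matrix.cons_val_one, map_one, map_mul,
    Complex.conj_ofReal, e, hH.sq_apply_self, Complex.normSq_ofReal, e3] at key
  set k := Complex.normSq ((H * H) u u')
  set d := (gainNbrs H u).card
  set d' := (gainNbrs H u').card
  have e4 : (1 * 1 * (d : ℂ) + 1 * (((0.7 : ℝ) : ℂ) * (H * H) u' u) * (H * H) u u' +
      (((0.7 : ℝ) : ℂ) * (H * H) u u' * 1 * (H * H) u' u +
        ((0.7 : ℝ) : ℂ) * (H * H) u u' * (((0.7 : ℝ) : ℂ) * (H * H) u' u) * (d' : ℂ))) =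
      ((d + 1.4 * k + 0.49 * k * d' : ℝ) : ℂ) := by
    push_cast
    linear_combination (1.4 + 0.49 * (d' : ℂ)) * e2
  rw [e4, Complex.ofReal_re] at key
  have d1 : (3 : ℝ) ≤ d := by exact_mod_cast hd
  have d2 : (3 : ℝ) ≤ d' := by exact_mod_cast hd'
  have h5 : k * 3 ≤ k * d' := mul_le_mul_of_nonneg_left d2 (by linarith)
  nlinarith [sqrt_five_bounds.2]

/-- Excludes a vertex `v` of degree at least `3` with the opposite vertex `x` of a `4`-cycle through
`v` and a further vertex `z` at distance `2` from `v`, which has no neighbour in common with `x`. -/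
theorem no_four_cycle_with_tail (hH : AdmissibleGain H col) {v x z : W} (hvx : v ≠ x) (hvz : v ≠ z)
    (hxz : x ≠ z) (kx : 2 ≤ Complex.normSq ((H * H) v x)) (kz : 1 ≤ Complex.normSq ((H * H) v z))
    (h0 : (H * H) x z = 0) (dv : 3 ≤ (gainNbrs H v).card) (dx : 2 ≤ (gainNbrs H x).card)
    (dz : 2 ≤ (gainNbrs H z).card) : False := by
  have hinj : Function.Injective ![v, x, z] := by
    intro i j hij
    fin_cases i <;> fin_cases j <;> simp_all
  -- `0.45 ≈ 1 / √5`, where `√5 = (2 + √5) - 2` is what the degrees of `x` and `z` leave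
  have key := hH.gram_le hinj ![1, ((0.45 : ℝ) : ℂ) * (H * H) x v, ((0.45 : ℝ) : ℂ) * (H * H) z v]
  have h0' : (H * H) z x = 0 := by rw [← hH.conj_sq_apply, h0, map_zero]
  have e1 : ∀ w, (H * H) w v * (H * H) v w = (Complex.normSq ((H * H) v w) : ℂ) := by
    intro w
    rw [Complex.normSq_eq_conj_mul_self, hH.conj_sq_apply]
  have e3 : ∀ w, Complex.normSq ((H * H) w v) = Complex.normSq ((H * H) v w) := by
    intro w
    rw [← hH.conj_sq_apply, Complex.normSq_conj]
  simp only [Fin.sum_univ_three, Matrix.cons_val_zero, Matrix.cons_val_one, Matrix.cons_val,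
    map_one, map_mul, Complex.conj_ofReal, hH.conj_sq_apply, hH.sq_apply_self,
    Complex.normSq_ofReal, e3, h0, h0', mul_zero] at key
  have ex := e1 x
  have ez := e1 z
  set k := Complex.normSq ((H * H) v x)
  set l := Complex.normSq ((H * H) v z)
  set d := (gainNbrs H v).card
  set d' := (gainNbrs H x).card
  set d'' := (gainNbrs H z).card
  have key' : d + 0.9 * k + 0.9 * l + 0.2025 * k * d' + 0.2025 * l * d'' ≤
      (2 + √5) * (1 + 0.2025 * k + 0.2025 * l) := by
    rw [← Complex.ofReal_re (_ + _)]
    refine (congrArg Complex.re ?_).trans_le (key.trans (le_of_eq (by norm_num)))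
    push_cast
    linear_combination (-0.9 - 0.2025 * (d' : ℂ)) * ex + (-0.9 - 0.2025 * (d'' : ℂ)) * ez
  have d1 : (3 : ℝ) ≤ d := by exact_mod_cast dv
  have d2 : (2 : ℝ) ≤ d' := by exact_mod_cast dx
  have d3 : (2 : ℝ) ≤ d'' := by exact_mod_cast dz
  have h5 : k * 2 ≤ k * d' := mul_le_mul_of_nonneg_left d2 (by linarith)
  have h6 : l * 2 ≤ l * d'' := mul_le_mul_of_nonneg_left d3 (by linarith)
  nlinarith [sqrt_five_bounds.2]

end AdmissibleGain

/-! ### The neighbourhood of a branch vertex of the `2`-core -/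

/-- `w` lies in the `2`-core of the graph of `H`: in some set of vertices in which every vertex has
at least two neighbours. -/
def InCore {W : Type*} (H : Matrix W W ℂ) (w : W) : Prop :=
  ∃ S : Set W, w ∈ S ∧ ∀ u ∈ S, ∃ a ∈ S, ∃ b ∈ S, a ≠ b ∧ H u a ≠ 0 ∧ H u b ≠ 0

theorem InCore.exists_ne {W : Type*} {H : Matrix W W ℂ} {w : W} (h : InCore H w) (u : W) :
    ∃ u', u' ≠ u ∧ H w u' ≠ 0 ∧ InCore H u' := by
  obtain ⟨S, hw, hS⟩ := h
  obtain ⟨a, ha, b, hb, hab, h1, h2⟩ := hS w hw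
  by_cases hau : a = u
  · exact ⟨b, fun h => hab (hau.trans h.symm), h2, S, hb, hS⟩
  · exact ⟨a, hau, h1, S, ha, hS⟩

theorem InCore.of_two {W : Type*} {H : Matrix W W ℂ} {w a b : W} (ha : InCore H a)
    (hb : InCore H b) (hab : a ≠ b) (h1 : H w a ≠ 0) (h2 : H w b ≠ 0) : InCore H w := by
  obtain ⟨S, haS, hS⟩ := ha
  obtain ⟨S', hbS, hS'⟩ := hb
  refine ⟨insert w (S ∪ S'), Or.inl rfl, ?_⟩
  rintro u (rfl | hu | hu)
  · exact ⟨a, Or.inr (Or.inl haS), b, Or.inr (Or.inr hbS), hab, h1, h2⟩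
  · obtain ⟨c, hc, d, hd, h⟩ := hS u hu
    exact ⟨c, Or.inr (Or.inl hc), d, Or.inr (Or.inl hd), h⟩
  · obtain ⟨c, hc, d, hd, h⟩ := hS' u hu
    exact ⟨c, Or.inr (Or.inr hc), d, Or.inr (Or.inr hd), h⟩

/-- The ball of radius `2` around a branch vertex `v` of the `2`-core: `v` has exactly the three
neighbours `a`, `b`, `c`; each of them has exactly one further neighbour, `x`, `y`, `z` in turn;
`a`, `b`, `c` are distinct, `v`, `x`, `y`, `z` are distinct, and all lie in the `2`-core. -/
structure IsHub {W : Type*} (H : Matrix W W ℂ) (v a b c x y z : W) : Prop where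
  nv : ∀ w, H v w ≠ 0 ↔ w = a ∨ w = b ∨ w = c
  na : ∀ w, H a w ≠ 0 ↔ w = v ∨ w = x
  nb : ∀ w, H b w ≠ 0 ↔ w = v ∨ w = y
  nc : ∀ w, H c w ≠ 0 ↔ w = v ∨ w = z
  ab : a ≠ b
  ac : a ≠ c
  bc : b ≠ c
  vx : v ≠ x
  vy : v ≠ y
  vz : v ≠ z
  xy : x ≠ y
  xz : x ≠ z
  yz : y ≠ z
  core_a : InCore H a
  core_b : InCore H b
  core_c : InCore H c
  core_x : InCore H x
  core_y : InCore H y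
  core_z : InCore H z

namespace IsHub

variable {W : Type*} {H : Matrix W W ℂ} {v a b c x y z : W}

theorem swap (h : IsHub H v a b c x y z) : IsHub H v b a c y x z where
  nv w := by rw [h.nv]; tauto
  na := h.nb
  nb := h.na
  nc := h.nc
  ab := h.ab.symm
  ac := h.bc
  bc := h.ac
  vx := h.vy
  vy := h.vx
  vz := h.vz
  xy := h.xy.symm
  xz := h.yz
  yz := h.xz
  core_a := h.core_b
  core_b := h.core_a
  core_c := h.core_c
  core_x := h.core_y
  core_y := h.core_x
  core_z := h.core_z

theorem rotate (h : IsHub H v a b c x y z) : IsHub H v b c a y z x where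
  nv w := by rw [h.nv]; tauto
  na := h.nb
  nb := h.nc
  nc := h.na
  ab := h.bc
  ac := h.ab.symm
  bc := h.ac.symm
  vx := h.vy
  vy := h.vz
  vz := h.vx
  xy := h.yz
  xz := h.xy.symm
  yz := h.xz.symm
  core_a := h.core_b
  core_b := h.core_c
  core_c := h.core_a
  core_x := h.core_y
  core_y := h.core_z
  core_z := h.core_x

end IsHub

namespace AdmissibleGain

variable {W : Type*} [Fintype W] {H : Matrix W W ℂ} {col : W → Bool}

theorem two_le_card_of_inCore {w : W} (h : InCore H w) : 2 ≤ (gainNbrs H w).card := by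
  obtain ⟨S, hw, hS⟩ := h
  obtain ⟨a, ha, b, hb, hab, h1, h2⟩ := hS w hw
  exact two_le_card hab h1 h2

/-- The neighbours of a branch vertex of the `2`-core have degree `2`. -/
theorem card_nbr_le_two (hH : AdmissibleGain H col) {v a b c : W} (hab : a ≠ b) (hac : a ≠ c)
    (hbc : b ≠ c) (ha : H v a ≠ 0) (hb : H v b ≠ 0) (hc : H v c ≠ 0) (cb : InCore H b)
    (cc : InCore H c) : (gainNbrs H a).card ≤ 2 := by
  by_contra! h
  exact hH.star_three_two_two hab hac hbc ha hb hc h (two_le_card_of_inCore cb)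
    (two_le_card_of_inCore cc)

theorem exists_other_nbr (hH : AdmissibleGain H col) {v a : W} (ha : H v a ≠ 0) (ca : InCore H a)
    (da : (gainNbrs H a).card ≤ 2) :
    ∃ x, v ≠ x ∧ InCore H x ∧ ∀ w, H a w ≠ 0 ↔ w = v ∨ w = x := by
  obtain ⟨x, hx, hax, cx⟩ := ca.exists_ne v
  refine ⟨x, hx.symm, cx, fun w => ⟨eq_or_eq_of_card_le hx.symm (hH.symm ha) hax da, ?_⟩⟩
  rintro (rfl | rfl)
  exacts [hH.symm ha, hax]

/-- There is no `4`-cycle through a branch vertex. -/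
theorem no_four_cycle_at_branch (hH : AdmissibleGain H col) {v a b c x y z : W} (hab : a ≠ b)
    (hac : a ≠ c) (hbc : b ≠ c) (hv : ∀ w, H v w ≠ 0 ↔ w = a ∨ w = b ∨ w = c) (vx : v ≠ x)
    (vz : v ≠ z) (cx : InCore H x) (cz : InCore H z) (na : ∀ w, H a w ≠ 0 ↔ w = v ∨ w = x)
    (nb : ∀ w, H b w ≠ 0 ↔ w = v ∨ w = y) (nc : ∀ w, H c w ≠ 0 ↔ w = v ∨ w = z) : x ≠ y := by
  rintro rfl
  have va := (hv a).2 (by simp)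
  have vb := (hv b).2 (by simp)
  have vc := (hv c).2 (by simp)
  have ax := (na x).2 (by simp)
  have bx := (nb x).2 (by simp)
  have cz' := (nc z).2 (by simp)
  have dv : 3 ≤ (gainNbrs H v).card := three_le_card hab hac hbc va vb vc
  have dx := hH.card_lt_three_of_four_cycle vx hab va ax vb bx dv
  have hxz : x ≠ z := by
    rintro rfl
    have := three_le_card hab hac hbc (hH.symm ax) (hH.symm bx) (hH.symm cz')
    omega
  refine hH.no_four_cycle_with_tail vx vz hxz (hH.two_le_normSq vx hab va ax vb bx)
    (hH.one_le_normSq vz vc cz') ?_ dv (two_le_card_of_inCore cx) (two_le_card_of_inCore cz)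
  rw [Matrix.mul_apply]
  refine sum_eq_zero fun w _ => ?_
  by_contra h0
  rw [← ne_eq, mul_ne_zero_iff] at h0
  rcases eq_or_eq_of_card_le hab (hH.symm ax) (hH.symm bx) (by omega) h0.1 with rfl | rfl
  · rcases (na z).1 h0.2 with h | h
    exacts [vz h.symm, hxz h.symm]
  · rcases (nb z).1 h0.2 with h | h
    exacts [vz h.symm, hxz h.symm]

theorem exists_isHub (hH : AdmissibleGain H col) {v a b c : W} (hab : a ≠ b) (hac : a ≠ c)
    (hbc : b ≠ c) (ha : H v a ≠ 0) (hb : H v b ≠ 0) (hc : H v c ≠ 0) (ca : InCore H a)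
    (cb : InCore H b) (cc : InCore H c) : ∃ x y z, IsHub H v a b c x y z := by
  obtain ⟨x, vx, cx, na⟩ := hH.exists_other_nbr ha ca
    (hH.card_nbr_le_two hab hac hbc ha hb hc cb cc)
  obtain ⟨y, vy, cy, nb⟩ := hH.exists_other_nbr hb cb
    (hH.card_nbr_le_two hab.symm hbc hac hb ha hc ca cc)
  obtain ⟨z, vz, cz, nc⟩ := hH.exists_other_nbr hc cc
    (hH.card_nbr_le_two hac.symm hbc.symm hab hc ha hb ca cb)
  have dv : (gainNbrs H v).card ≤ 3 := hH.card_le_three vx ha ((na x).2 (by simp))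
  have hv : ∀ w, H v w ≠ 0 ↔ w = a ∨ w = b ∨ w = c := by
    refine fun w => ⟨eq_or_eq_or_eq_of_card_le hab hac hbc ha hb hc dv, ?_⟩
    rintro (rfl | rfl | rfl) <;> assumption
  refine ⟨x, y, z, hv, na, nb, nc, hab, hac, hbc, vx, vy, vz, ?_, ?_, ?_, ca, cb, cc, cx, cy, cz⟩
  · exact hH.no_four_cycle_at_branch hab hac hbc hv vx vz cx cz na nb nc
  · exact hH.no_four_cycle_at_branch hac hab hbc.symm (fun w => by rw [hv]; tauto) vx vy cx cy
      na nc nb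
  · exact hH.no_four_cycle_at_branch hbc hab.symm hac.symm (fun w => by rw [hv]; tauto) vy vx cy cx
      nb nc na

end AdmissibleGain

/-! ### Pairs of vertices at distance two from a hub -/

/-- The entry of `H ^ 2` at `(x, y)`, transported to `v` along the paths `v a x` and `v b y`. If `p`
is the only common neighbour of `x` and `y`, this is the weight of the hexagon `v a x p y b`. -/
noncomputable def hexWeight {W : Type*} [Fintype W] (H : Matrix W W ℂ) (v a b x y : W) : ℂ :=
  H v a * H a x * (H * H) x y * (H y b * H b v)

namespace AdmissibleGain

variable {W : Type*} [Fintype W] {H : Matrix W W ℂ} {col : W → Bool} {v a b c x y z : W}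

theorem col_eq (hH : AdmissibleGain H col) {u w w' : W} (h : H u w ≠ 0) (h' : H w w' ≠ 0) :
    col u = col w' := by
  have h1 := hH.col_ne h
  have h2 := hH.col_ne h'
  revert h1 h2
  cases col u <;> cases col w <;> cases col w' <;> simp

theorem eq_zero_of_col_eq (hH : AdmissibleGain H col) {u w : W} (h : col u = col w) :
    H u w = 0 := by
  by_contra h'
  exact hH.col_ne h' h

theorem hexWeight_conj (hH : AdmissibleGain H col) :
    starRingEnd ℂ (hexWeight H v a b x y) = hexWeight H v b a y x := by
  simp only [hexWeight, map_mul, hH.conj_apply, hH.conj_sq_apply]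
  ring

theorem hexWeight_swap (hH : AdmissibleGain H col) {ε : ℤ}
    (h : hexWeight H v a b x y = ε) : hexWeight H v b a y x = ε := by
  rw [← hH.hexWeight_conj, h]
  simp

theorem sq_apply_hub (h : IsHub H v a b c x y z) : (H * H) v x = H v a * H a x := by
  rw [Matrix.mul_apply, sum_eq_single a _ (by simp)]
  intro w _ hw
  by_contra h0
  rw [← ne_eq, mul_ne_zero_iff, h.nv] at h0
  obtain ⟨rfl | rfl | rfl, h2⟩ := h0
  · exact hw rfl
  · rcases (h.nb _).1 h2 with h' | h'
    exacts [h.vx h'.symm, h.xy h']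
  · rcases (h.nc _).1 h2 with h' | h'
    exacts [h.vx h'.symm, h.xz h']

/-- The principal submatrix of `H ^ 2` on `v, x, y, z`, switched so that its first row is
positive. -/
theorem hub_gram (hH : AdmissibleGain H col) (h : IsHub H v a b c x y z) (r₀ r₁ r₂ r₃ : ℝ) :
    3 * r₀ ^ 2 + (gainNbrs H x).card * r₁ ^ 2 + (gainNbrs H y).card * r₂ ^ 2 +
      (gainNbrs H z).card * r₃ ^ 2 + 2 * r₀ * (r₁ + r₂ + r₃) +
      2 * (r₁ * r₂ * (hexWeight H v a b x y).re + r₁ * r₃ * (hexWeight H v a c x z).re +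
        r₂ * r₃ * (hexWeight H v b c y z).re) ≤
      (2 + √5) * (r₀ ^ 2 + r₁ ^ 2 + r₂ ^ 2 + r₃ ^ 2) := by
  have hinj : Function.Injective ![v, x, y, z] := by
    have := h.vx; have := h.vy; have := h.vz; have := h.xy; have := h.xz; have := h.yz
    intro i j hij
    fin_cases i <;> fin_cases j <;> simp_all
  have va := (h.nv a).2 (by simp)
  have vb := (h.nv b).2 (by simp)
  have vc := (h.nv c).2 (by simp)
  have ax := (h.na x).2 (by simp)
  have hby := (h.nb y).2 (by simp)
  have cz := (h.nc z).2 (by simp)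
  have dv : (gainNbrs H v).card = 3 := le_antisymm (hH.card_le_three h.vx va ax)
    (three_le_card h.ab h.ac h.bc va vb vc)
  have key := hH.gram_le hinj ![(r₀ : ℂ), r₁ * (H x a * H a v), r₂ * (H y b * H b v),
    r₃ * (H z c * H c v)]
  have px := sq_apply_hub h
  have py := sq_apply_hub h.swap
  have pz := sq_apply_hub h.rotate.rotate
  have px' : (H * H) x v = H x a * H a v := by
    rw [← hH.conj_sq_apply, px, map_mul, hH.conj_apply, hH.conj_apply, mul_comm]
  have py' : (H * H) y v = H y b * H b v := by
    rw [← hH.conj_sq_apply, py, map_mul, hH.conj_apply, hH.conj_apply, mul_comm]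
  have pz' : (H * H) z v = H z c * H c v := by
    rw [← hH.conj_sq_apply, pz, map_mul, hH.conj_apply, hH.conj_apply, mul_comm]
  have nx : Complex.normSq (H x a * H a v) = 1 :=
    ((hH.isGaussUnit (hH.symm ax)).mul (hH.isGaussUnit (hH.symm va))).normSq
  have ny : Complex.normSq (H y b * H b v) = 1 :=
    ((hH.isGaussUnit (hH.symm hby)).mul (hH.isGaussUnit (hH.symm vb))).normSq
  have nz : Complex.normSq (H z c * H c v) = 1 :=
    ((hH.isGaussUnit (hH.symm cz)).mul (hH.isGaussUnit (hH.symm vc))).normSq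
  have ux : H v a * H a x * (H x a * H a v) = 1 := by
    linear_combination (H a x * H x a) * hH.mul_symm va + hH.mul_symm ax
  have uy : H v b * H b y * (H y b * H b v) = 1 := by
    linear_combination (H b y * H y b) * hH.mul_symm vb + hH.mul_symm hby
  have uz : H v c * H c z * (H z c * H c v) = 1 := by
    linear_combination (H c z * H z c) * hH.mul_symm vc + hH.mul_symm cz
  have cxy := hH.hexWeight_conj (v := v) (a := a) (b := b) (x := x) (y := y)
  have cxz := hH.hexWeight_conj (v := v) (a := a) (b := c) (x := x) (y := z)
  have cyz := hH.hexWeight_conj (v := v) (a := b) (b := c) (x := y) (y := z)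
  simp only [Fin.sum_univ_four, Matrix.cons_val_zero, Matrix.cons_val_one, Matrix.cons_val,
    map_mul, Complex.conj_ofReal, hH.conj_apply, hH.sq_apply_self,
    Complex.normSq_ofReal, px, py, pz, px', py', pz', dv] at key
  simp only [← map_mul, nx, ny, nz] at key
  refine le_trans (le_of_eq ?_) (key.trans (le_of_eq (by ring)))
  have hre : ∀ w : ℂ, ((w.re : ℝ) : ℂ) = (w + starRingEnd ℂ w) / 2 := by
    intro w
    rw [Complex.add_conj]
    push_cast
    ring
  rw [← Complex.ofReal_re (_ + _)]
  congr 1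
  push_cast
  rw [hre, hre, hre, cxy, cxz, cyz]
  simp only [hexWeight]
  linear_combination (-2 * (r₀ : ℂ) * r₁ - r₁ ^ 2 * ((gainNbrs H x).card : ℂ)) * ux +
    (-2 * (r₀ : ℂ) * r₂ - r₂ ^ 2 * ((gainNbrs H y).card : ℂ)) * uy +
    (-2 * (r₀ : ℂ) * r₃ - r₃ ^ 2 * ((gainNbrs H z).card : ℂ)) * uz

/-- Two of the vertices at distance `2` from a hub have at most one common neighbour. -/
theorem hexWeight_cases (hH : AdmissibleGain H col) (h : IsHub H v a b c x y z) :
    (hexWeight H v a b x y = 0 ∧ ∀ p, H x p ≠ 0 → H p y = 0) ∨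
    ∃ p, H x p ≠ 0 ∧ H p y ≠ 0 ∧ (∀ p', H x p' ≠ 0 → H p' y ≠ 0 → p' = p) ∧
      hexWeight H v a b x y = H v a * H a x * (H x p * H p y) * (H y b * H b v) ∧
      IsGaussUnit (hexWeight H v a b x y) := by
  by_cases hp : ∃ p, H x p ≠ 0 ∧ H p y ≠ 0
  · right
    obtain ⟨p, h1, h2⟩ := hp
    have ax := (h.na x).2 (by simp)
    have hby := (h.nb y).2 (by simp)
    have hu : ∀ p', H x p' ≠ 0 → H p' y ≠ 0 → p' = p := by
      intro p' h3 h4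
      by_contra hne
      have ha : ∀ q, H q y ≠ 0 → a ≠ q := by
        rintro q hq rfl
        rcases (h.na _).1 hq with h' | h'
        exacts [h.vy h'.symm, h.xy h'.symm]
      have hb : ∀ q, H x q ≠ 0 → b ≠ q := by
        rintro q hq rfl
        rcases (h.nb _).1 (hH.symm hq) with h' | h'
        exacts [h.vx h'.symm, h.xy h']
      have d1 := three_le_card (ha p h2) (ha p' h4) (Ne.symm hne) (hH.symm ax) h1 h3
      have d2 := three_le_card (hb p h1) (hb p' h3) (Ne.symm hne) (hH.symm hby) (hH.symm h2)
        (hH.symm h4)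
      have := hH.card_lt_three_of_four_cycle h.xy (Ne.symm hne) h1 h2 h3 h4 d1
      omega
    have e : (H * H) x y = H x p * H p y := by
      rw [Matrix.mul_apply, sum_eq_single p _ (by simp)]
      intro w _ hw
      by_contra h0
      rw [← ne_eq, mul_ne_zero_iff] at h0
      exact hw (hu w h0.1 h0.2)
    refine ⟨p, h1, h2, hu, by rw [hexWeight, e], ?_⟩
    rw [hexWeight, e]
    exact (((hH.isGaussUnit ((h.nv a).2 (by simp))).mul (hH.isGaussUnit ax)).mul
      ((hH.isGaussUnit h1).mul (hH.isGaussUnit h2))).mul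
      ((hH.isGaussUnit (hH.symm hby)).mul (hH.isGaussUnit (hH.symm ((h.nv b).2 (by simp)))))
  · left
    push Not at hp
    refine ⟨?_, hp⟩
    rw [hexWeight, Matrix.mul_apply, sum_eq_zero]
    · simp
    · intro w _
      by_cases h1 : H x w = 0
      · simp [h1]
      · simp [hp w h1]

/-- The weight is `-1` unless its real part is nonnegative, which the Gram inequality punishes. -/
theorem eq_neg_one_or_re_nonneg (hH : AdmissibleGain H col) (h : IsHub H v a b c x y z) :
    hexWeight H v a b x y = -1 ∨ 0 ≤ (hexWeight H v a b x y).re := by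
  by_cases h1 : hexWeight H v a b x y = -1
  · exact Or.inl h1
  right
  rcases hH.hexWeight_cases h with ⟨h0, -⟩ | ⟨p, -, -, -, -, hg⟩
  · simp [h0]
  · exact hg.re_nonneg h1

theorem hub_card (hH : AdmissibleGain H col) (h : IsHub H v a b c x y z) :
    (gainNbrs H x).card = 2 ∨ (gainNbrs H x).card = 3 := by
  have h1 := two_le_card_of_inCore h.core_x
  have h2 := hH.card_le_three h.vx.symm (hH.symm ((h.na x).2 (by simp)))
    ((h.na v).2 (by simp))
  omega

/-- A second neighbour of degree `3` lies on negative hexagons with both other second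
neighbours. -/
theorem hexWeight_of_card_three (hH : AdmissibleGain H col) (h : IsHub H v a b c x y z)
    (hx : (gainNbrs H x).card = 3) : hexWeight H v a b x y = -1 := by
  refine (hH.eq_neg_one_or_re_nonneg h).resolve_right fun h1 => ?_
  -- `0.809 ≈ 1 / (2 + √5 - 3)` and `0.447 ≈ 1 / (2 + √5 - 2)`
  have key := hH.hub_gram h 1 0.809 0.447 0
  have hy : (2 : ℝ) ≤ (gainNbrs H y).card := by
    exact_mod_cast two_le_card_of_inCore h.core_y
  rw [hx] at key
  norm_num at key
  nlinarith [sqrt_five_bounds.2]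

/-- Already the principal submatrix of `H ^ 2` on `v`, `x`, `y` excludes a hexagon of weight `1`. -/
theorem hexWeight_ne_one (hH : AdmissibleGain H col) (h : IsHub H v a b c x y z) :
    hexWeight H v a b x y ≠ 1 := by
  intro h1
  have key := hH.hub_gram h 1.6 1 1 0
  have hx : (2 : ℝ) ≤ (gainNbrs H x).card := by
    exact_mod_cast two_le_card_of_inCore h.core_x
  have hy : (2 : ℝ) ≤ (gainNbrs H y).card := by
    exact_mod_cast two_le_card_of_inCore h.core_y
  rw [h1, Complex.one_re] at key
  norm_num at key
  nlinarith [sqrt_five_bounds.2]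

/-- Some hexagon at a hub is negative. Without one, `T ^ 2` is exceeded already as for the tree that
consists of three paths of length `3` with a common end. -/
theorem exists_hexWeight_eq_neg_one (hH : AdmissibleGain H col) (h : IsHub H v a b c x y z) :
    hexWeight H v a b x y = -1 ∨ hexWeight H v a c x z = -1 ∨ hexWeight H v b c y z = -1 := by
  by_contra! hne
  have h1 := (hH.eq_neg_one_or_re_nonneg h).resolve_left hne.1
  have h2 : 0 ≤ (hexWeight H v a c x z).re := by
    rw [← Complex.conj_re, hH.hexWeight_conj]
    refine (hH.eq_neg_one_or_re_nonneg h.rotate.rotate).resolve_left fun h' => hne.2.1 ?_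
    simpa using hH.hexWeight_swap (ε := -1) (by simpa using h')
  have h3 := (hH.eq_neg_one_or_re_nonneg h.rotate).resolve_left hne.2.2
  -- `2.4 ≈ 3 / (2 + √5 - 3)`
  have key := hH.hub_gram h 2.4 1 1 1
  have hx : (2 : ℝ) ≤ (gainNbrs H x).card := by
    exact_mod_cast two_le_card_of_inCore h.core_x
  have hy : (2 : ℝ) ≤ (gainNbrs H y).card := by
    exact_mod_cast two_le_card_of_inCore h.core_y
  have hz : (2 : ℝ) ≤ (gainNbrs H z).card := by
    exact_mod_cast two_le_card_of_inCore h.core_z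
  norm_num at key
  nlinarith [sqrt_five_bounds.2]

end AdmissibleGain

/-! ### A negative hexagon with a tail -/

open Classical in
/-- An extremal vector on a negative hexagon with a tail that has been explored from the hexagon up
to the vertex `u`, with next vertex `u'`. With `t ^ 4 = t ^ 2 + 1` and hence `T = t ^ 3` for
`T = √(2 + √5)` and `t⁻¹ = t ^ 3 - t`, the field `mulVec` says that `f` satisfies the eigenvalue
equation `H f = T f` everywhere except at `u` and `u'`. The vertex `p` of the hexagon opposite to
the tail is adjacent to the support of `f` but invisible to `f`, its neighbours `x` and `y` on the
hexagon contributing with opposite signs. The field `closed` says that the edges leaving the support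
of `f` end at `p` or are the edge from `u` to `u'`. -/
structure IsTailVector {W : Type*} [Fintype W] (H : Matrix W W ℂ) (t : ℝ) (p x y u u' : W)
    (f : W → ℂ) : Prop where
  core : InCore H u'
  adj : H u' u ≠ 0
  unit : IsGaussUnit (f u)
  apply_next : f u' = 0
  apply_x : f x ≠ 0
  apply_y : f y ≠ 0
  ne_x : u ≠ x
  ne_y : u ≠ y
  mulVec : ∀ w, (H *ᵥ f) w = (t : ℂ) ^ 3 * f w - (if w = u then ((t : ℂ) ^ 3 - t) * f u else 0) +
    if w = u' then H u' u * f u else 0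
  closed : ∀ w w', f w ≠ 0 → H w w' ≠ 0 → f w' ≠ 0 ∨ w' = p ∨ (w = u ∧ w' = u')

namespace AdmissibleGain

variable {W : Type*} [Fintype W] {H : Matrix W W ℂ} {col : W → Bool}

/-- The bound on `‖H f‖` implies the one on the quadratic form of `H`. -/
theorem form_le (hH : AdmissibleGain H col) {t : ℝ} (ht : 0 < t) (ht2 : 2 * t ^ 2 = 1 + √5)
    (f : W → ℂ) :
    (∑ w, starRingEnd ℂ (f w) * (H *ᵥ f) w).re ≤ t ^ 3 * (∑ w, starRingEnd ℂ (f w) * f w).re := by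
  have h5 : √5 ^ 2 = 5 := Real.sq_sqrt (by norm_num)
  have ht6 : (t ^ 3) ^ 2 = 2 + √5 := by
    have : t ^ 2 = (1 + √5) / 2 := by linarith
    calc (t ^ 3) ^ 2 = (t ^ 2) ^ 3 := by ring
      _ = 2 + √5 := by rw [this]; linear_combination (3 + √5) / 8 * h5
  have h1 := hH.norm_le f
  rw [← ht6] at h1
  have h2 : ∀ w, 2 * t ^ 3 * (starRingEnd ℂ (f w) * (H *ᵥ f) w).re ≤
      (t ^ 3) ^ 2 * Complex.normSq (f w) + Complex.normSq ((H *ᵥ f) w) := by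
    intro w
    have := Complex.normSq_nonneg ((t ^ 3 : ℝ) * f w - (H *ᵥ f) w)
    rw [Complex.normSq_apply, Complex.sub_re, Complex.sub_im, Complex.re_ofReal_mul,
      Complex.im_ofReal_mul] at this
    rw [Complex.normSq_apply, Complex.normSq_apply, Complex.mul_re, Complex.conj_re,
      Complex.conj_im]
    nlinarith
  have h3 := sum_le_sum fun w (_ : w ∈ univ) => h2 w
  rw [← mul_sum, sum_add_distrib, ← mul_sum] at h3
  have h4 : (∑ w, starRingEnd ℂ (f w) * f w).re = ∑ w, Complex.normSq (f w) := by
    rw [Complex.re_sum]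
    refine sum_congr rfl fun w _ => ?_
    rw [← Complex.normSq_eq_conj_mul_self, Complex.ofReal_re]
  rw [h4, Complex.re_sum]
  have h6 : 0 < t ^ 3 := by positivity
  refine le_of_mul_le_mul_left ?_ (show 0 < 2 * t ^ 3 by positivity)
  linarith

theorem golden_bounds {t : ℝ} (ht : 0 < t) (ht2 : 2 * t ^ 2 = 1 + √5) :
    t ^ 4 = t ^ 2 + 1 ∧ 5 * t ^ 3 - 2 * t < 8 := by
  have h5 : √5 ^ 2 = 5 := Real.sq_sqrt (by norm_num)
  have h2 : t ^ 2 = (1 + √5) / 2 := by linarith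
  refine ⟨?_, ?_⟩
  · calc t ^ 4 = (t ^ 2) ^ 2 := by ring
      _ = t ^ 2 + 1 := by rw [h2]; linear_combination h5 / 4
  · have h6 : t < 1.2721 := by
      refine lt_of_pow_lt_pow_left₀ 2 (by norm_num) ?_
      rw [h2]
      norm_num
      linarith [sqrt_five_bounds.2]
    have h7 : 5 * t ^ 3 - 2 * t = t * (5 * t ^ 2 - 2) := by ring
    rw [h7, h2]
    nlinarith [sqrt_five_bounds.2, sqrt_five_bounds.1]

/-- The vertex after the explored part of the tail has degree `2`: otherwise, extending the vector
to it and to two further neighbours exceeds the bound. -/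
theorem IsTailVector.card_le_two (hH : AdmissibleGain H col) {t : ℝ} (ht : 0 < t)
    (ht2 : 2 * t ^ 2 = 1 + √5) {p x y u u' : W} {f : W → ℂ}
    (hf : IsTailVector H t p x y u u' f) : (gainNbrs H u').card ≤ 2 := by
  classical
  by_contra! h3
  obtain ⟨e₁, h1, e₂, h2, h12⟩ : ∃ e₁ ∈ (gainNbrs H u').erase u, ∃ e₂ ∈ (gainNbrs H u').erase u,
      e₁ ≠ e₂ := by
    refine Finset.one_lt_card.1 ?_
    rw [card_erase_of_mem (mem_gainNbrs.2 hf.adj)]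
    omega
  rw [mem_erase, mem_gainNbrs] at h1 h2
  obtain ⟨n1, a1⟩ := h1
  obtain ⟨n2, a2⟩ := h2
  set η := H u' u * f u with hη
  have gη : IsGaussUnit η := (hH.isGaussUnit hf.adj).mul hf.unit
  -- `k` is the vector `η (δ_{u'} + (H δ_{u'}) / 2)`, restricted to `u'`, `e₁` and `e₂`
  set k : W → ℂ := fun w => (if w = u' then η else 0) + (if w = e₁ then H e₁ u' * η / 2 else 0) +
    (if w = e₂ then H e₂ u' * η / 2 else 0) with hk
  have m1 := hH.ne a1
  have m2 := hH.ne a2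
  have ku : k u' = η := by simp [hk, m1, m2]
  have k1 : k e₁ = H e₁ u' * η / 2 := by simp [hk, m1.symm, h12]
  have k2 : k e₂ = H e₂ u' * η / 2 := by simp [hk, m2.symm, h12.symm]
  have hsum : ∀ F : W → ℂ, ∑ w, starRingEnd ℂ (k w) * F w = starRingEnd ℂ η * F u' +
      starRingEnd ℂ (H e₁ u' * η / 2) * F e₁ + starRingEnd ℂ (H e₂ u' * η / 2) * F e₂ := by
    intro F
    simp only [hk, map_add, add_mul, sum_add_distrib, apply_ite (starRingEnd ℂ), map_zero, ite_mul,
      zero_mul, sum_ite_eq', mem_univ, if_true]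
  have hsum' : ∀ F : W → ℂ, ∑ w, F w * k w = F u' * η + F e₁ * (H e₁ u' * η / 2) +
      F e₂ * (H e₂ u' * η / 2) := by
    intro F
    simp only [hk, mul_add, sum_add_distrib, mul_ite, mul_zero, sum_ite_eq', mem_univ, if_true]
  have Hk : ∀ w, (H *ᵥ k) w = H w u' * η + H w e₁ * (H e₁ u' * η / 2) +
      H w e₂ * (H e₂ u' * η / 2) := fun w => by
    simpa only [Matrix.mulVec, dotProduct] using hsum' fun w' => H w w'
  have key := hH.form_le ht ht2 (f + k)
  have hsymm : ∑ w, starRingEnd ℂ (f w) * (H *ᵥ k) w =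
      starRingEnd ℂ (∑ w, starRingEnd ℂ (k w) * (H *ᵥ f) w) := by
    simp only [Matrix.mulVec, dotProduct, map_sum, map_mul, Complex.conj_conj, mul_sum,
      hH.conj_apply]
    rw [sum_comm]
    exact sum_congr rfl fun w _ => sum_congr rfl fun w' _ => by ring
  have hsymm' : ∑ w, starRingEnd ℂ (f w) * k w =
      starRingEnd ℂ (∑ w, starRingEnd ℂ (k w) * f w) := by
    simp only [map_sum, map_mul, Complex.conj_conj]
    exact sum_congr rfl fun w _ => by ring
  have hz : H e₁ e₂ = 0 := hH.eq_zero_of_col_eq (hH.col_eq (hH.symm a1) a2)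
  have hz' : H e₂ e₁ = 0 := hH.eq_zero_of_col_eq (hH.col_eq (hH.symm a2) a1)
  have hz0 : ∀ w, H w w = 0 := fun w => hH.eq_zero_of_col_eq rfl
  have nu : u' ≠ u := hH.ne hf.adj
  have Fu : (H *ᵥ f) u' = η := by
    rw [hf.mulVec, hf.apply_next, if_neg nu, if_pos rfl]
    simp [hη]
  have F1 : (H *ᵥ f) e₁ = (t : ℂ) ^ 3 * f e₁ := by
    rw [hf.mulVec, if_neg n1, if_neg m1.symm]
    simp
  have F2 : (H *ᵥ f) e₂ = (t : ℂ) ^ 3 * f e₂ := by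
    rw [hf.mulVec, if_neg n2, if_neg m2.symm]
    simp
  have c0 : starRingEnd ℂ η * η = 1 := gη.conj_mul
  have c1 := hH.mul_symm a1
  have c2 := hH.mul_symm a2
  have kk : ∑ w, starRingEnd ℂ (k w) * k w = 3 / 2 := by
    rw [hsum, ku, k1, k2]
    simp only [map_mul, map_div₀, map_ofNat, hH.conj_apply]
    linear_combination (1 + (H u' e₁ * H e₁ u' + H u' e₂ * H e₂ u') / 4) * c0 + c1 / 4 + c2 / 4
  have kHk : ∑ w, starRingEnd ℂ (k w) * (H *ᵥ k) w = 2 := by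
    rw [hsum, Hk, Hk, Hk]
    simp only [map_mul, map_div₀, map_ofNat, hH.conj_apply, hz, hz', hz0]
    linear_combination (H u' e₁ * H e₁ u' + H u' e₂ * H e₂ u') * c0 + c1 + c2
  have kf : ∑ w, starRingEnd ℂ (k w) * (H *ᵥ f) w =
      1 + (t : ℂ) ^ 3 * ∑ w, starRingEnd ℂ (k w) * f w := by
    rw [hsum, hsum, Fu, F1, F2, hf.apply_next, c0]
    ring
  have cf : starRingEnd ℂ (f u) * f u = 1 := hf.unit.conj_mul
  have ff : ∑ w, starRingEnd ℂ (f w) * (H *ᵥ f) w =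
      (t : ℂ) ^ 3 * ∑ w, starRingEnd ℂ (f w) * f w - ((t : ℂ) ^ 3 - t) := by
    simp only [hf.mulVec, mul_add, mul_sub, sum_add_distrib, sum_sub_distrib, mul_ite, mul_zero,
      sum_ite_eq', mem_univ, if_true, hf.apply_next, map_zero, zero_mul, mul_sum]
    rw [add_zero]
    congr 1
    · exact sum_congr rfl fun w _ => by ring
    · linear_combination ((t : ℂ) ^ 3 - t) * cf
  have lhs : ∑ w, starRingEnd ℂ ((f + k) w) * (H *ᵥ (f + k)) w =
      ∑ w, starRingEnd ℂ (f w) * (H *ᵥ f) w + ∑ w, starRingEnd ℂ (f w) * (H *ᵥ k) w +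
      ∑ w, starRingEnd ℂ (k w) * (H *ᵥ f) w + ∑ w, starRingEnd ℂ (k w) * (H *ᵥ k) w := by
    simp only [Matrix.mulVec_add, Pi.add_apply, map_add, ← sum_add_distrib]
    exact sum_congr rfl fun w _ => by ring
  have rhs : ∑ w, starRingEnd ℂ ((f + k) w) * (f + k) w =
      ∑ w, starRingEnd ℂ (f w) * f w + ∑ w, starRingEnd ℂ (f w) * k w +
      ∑ w, starRingEnd ℂ (k w) * f w + ∑ w, starRingEnd ℂ (k w) * k w := by
    simp only [Pi.add_apply, map_add, ← sum_add_distrib]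
    exact sum_congr rfl fun w _ => by ring
  rw [lhs, rhs, hsymm, hsymm', ff, kHk, kk, kf] at key
  simp only [← Complex.ofReal_pow, Complex.add_re, Complex.sub_re, Complex.conj_re,
    Complex.re_ofReal_mul, Complex.ofReal_re, Complex.one_re] at key
  norm_num at key
  linarith [(golden_bounds ht ht2).2]

/-- One step along the tail. -/
theorem IsTailVector.extend (hH : AdmissibleGain H col) {t : ℝ} (ht : 0 < t)
    (ht2 : 2 * t ^ 2 = 1 + √5) {p x y u u' : W} {f : W → ℂ} (hxy : x ≠ y) (hpx : H p x ≠ 0)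
    (hpy : H p y ≠ 0) (hf : IsTailVector H t p x y u u' f) :
    ∃ u'' g, IsTailVector H t p x y u' u'' g ∧ (∀ w, f w ≠ 0 → g w ≠ 0) ∧ g u' ≠ 0 := by
  classical
  have hd := IsTailVector.card_le_two hH ht ht2 hf
  have hp : u' ≠ p := by
    rintro rfl
    have := three_le_card hf.ne_x hf.ne_y hxy hf.adj hpx hpy
    omega
  obtain ⟨u'', h1, h2, h3⟩ := hf.core.exists_ne u
  have nbr : ∀ w, H u' w ≠ 0 → w = u ∨ w = u'' :=
    fun w => eq_or_eq_of_card_le h1.symm hf.adj h2 hd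
  have n1 : u' ≠ u := hH.ne hf.adj
  have n2 : u' ≠ u'' := hH.ne h2
  set η := H u' u * f u with hη
  have gη : IsGaussUnit η := (hH.isGaussUnit hf.adj).mul hf.unit
  have t0 : (t : ℂ) ≠ 0 := by exact_mod_cast ht.ne'
  have t4 : (t : ℂ) ^ 4 = (t : ℂ) ^ 2 + 1 := by exact_mod_cast (golden_bounds ht ht2).1
  have f2 : f u'' = 0 := by
    by_contra h0
    rcases hf.closed _ _ h0 (hH.symm h2) with h | h | h
    exacts [h hf.apply_next, hp h, h1 h.1]
  -- the values grow by the factor `t` for each step back from the new last vertex `u'`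
  set g : W → ℂ := fun w => if w = u' then η else t * f w with hg
  have gu : g u' = η := if_pos rfl
  have gw : ∀ w, w ≠ u' → g w = t * f w := fun w hw => if_neg hw
  have gne : ∀ w, f w ≠ 0 → g w ≠ 0 := by
    intro w hw
    rw [gw w (by rintro rfl; exact hw hf.apply_next)]
    exact mul_ne_zero t0 hw
  have Hg : ∀ w, (H *ᵥ g) w = t * (H *ᵥ f) w + H w u' * η := by
    intro w
    have : g = (t : ℂ) • f + Pi.single u' η := by
      ext w'
      by_cases h : w' = u'
      · subst h
        simp [gu, hf.apply_next]
      · simp [gw w' h, h]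
    rw [this, Matrix.mulVec_add, Matrix.mulVec_smul, Pi.add_apply, Pi.smul_apply, smul_eq_mul,
      Matrix.mulVec_single]
    simp
  refine ⟨u'', g, ⟨h3, hH.symm h2, gu ▸ gη, ?_, gne x hf.apply_x, gne y hf.apply_y, ?_, ?_, ?_, ?_⟩,
    gne, by rw [gu]; exact gη.ne_zero⟩
  · rw [gw _ n2.symm, f2, mul_zero]
  · rintro rfl
    exact hf.apply_x hf.apply_next
  · rintro rfl
    exact hf.apply_y hf.apply_next
  · intro w
    rw [Hg, hf.mulVec]
    by_cases hw1 : w = u'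
    · subst hw1
      rw [if_neg n1, if_pos rfl, if_pos rfl, if_neg n2, gu, hf.apply_next,
        hH.eq_zero_of_col_eq rfl]
      ring
    by_cases hw2 : w = u
    · subst hw2
      rw [if_pos rfl, if_neg hw1, if_neg hw1, if_neg h1.symm, gw _ hw1]
      have := hH.mul_symm hf.adj
      rw [hη]
      linear_combination f w * this - f w * t4
    · rw [if_neg hw2, if_neg hw1, if_neg hw1, gw _ hw1, gu]
      by_cases hw3 : w = u''
      · subst hw3
        rw [if_pos rfl]
        ring
      · have : H w u' = 0 := by
          by_contra h
          rcases nbr w (hH.symm h) with h | h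
          exacts [hw2 h, hw3 h]
        rw [if_neg hw3, this]
        ring
  · intro w w' hw hww'
    by_cases hw1 : w = u'
    · subst hw1
      rcases nbr w' hww' with h | h
      · exact Or.inl (gne _ (by rw [h]; exact hf.unit.ne_zero))
      · exact Or.inr (Or.inr ⟨rfl, h⟩)
    · rw [gw w hw1] at hw
      rcases hf.closed w w' (right_ne_zero_of_mul hw) hww' with h | h | h
      · exact Or.inl (gne _ h)
      · exact Or.inr (Or.inl h)
      · left
        rw [h.2, gu]
        exact gη.ne_zero

/-- The tail cannot continue for ever in a finite graph. -/
theorem not_isTailVector (hH : AdmissibleGain H col) {t : ℝ} (ht : 0 < t)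
    (ht2 : 2 * t ^ 2 = 1 + √5) {p x y : W} (hxy : x ≠ y) (hpx : H p x ≠ 0) (hpy : H p y ≠ 0) :
    ∀ (n : ℕ) (u u' : W) (f : W → ℂ), (univ.filter fun w => f w = 0).card ≤ n →
      ¬ IsTailVector H t p x y u u' f := by
  intro n
  induction n with
  | zero =>
    intro u u' f hn hf
    have := card_eq_zero.1 (Nat.le_zero.1 hn)
    have h : u' ∈ (univ.filter fun w => f w = 0) := by simpa using hf.apply_next
    simp [this] at h
  | succ n ih =>
    intro u u' f hn hf
    obtain ⟨u'', g, hg, h1, h2⟩ := IsTailVector.extend hH ht ht2 hxy hpx hpy hf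
    refine ih u' u'' g ?_ hg
    refine Nat.le_of_lt_succ (lt_of_lt_of_le (card_lt_card ?_) hn)
    refine ssubset_iff_of_subset (fun w => ?_) |>.2 ⟨u', ?_, ?_⟩
    · simp only [mem_filter, mem_univ, true_and]
      exact fun h => by_contra fun h' => h1 w h' h
    · simpa using hf.apply_next
    · simpa using h2

/-- If the vertices `x` and `y` at distance `2` from a hub both have degree `2`, they are not on a
negative hexagon with the hub. -/
theorem hexWeight_ne_neg_one (hH : AdmissibleGain H col) {v a b c x y z : W}
    (h : IsHub H v a b c x y z) (hx : (gainNbrs H x).card = 2) (hy : (gainNbrs H y).card = 2) :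
    hexWeight H v a b x y ≠ -1 := by
  classical
  intro hw
  rcases hH.hexWeight_cases h with ⟨h0, -⟩ | ⟨p, hxp, hpy, -, hp, -⟩
  · rw [h0] at hw
    norm_num at hw
  rw [hp] at hw
  have va := (h.nv a).2 (by simp)
  have vb := (h.nv b).2 (by simp)
  have vc := (h.nv c).2 (by simp)
  have ax := (h.na x).2 (by simp)
  have hby := (h.nb y).2 (by simp)
  have pa : a ≠ p := by
    rintro rfl
    rcases (h.na _).1 hpy with h' | h'
    exacts [h.vy h'.symm, h.xy h'.symm]
  have pb : b ≠ p := by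
    rintro rfl
    rcases (h.nb _).1 (hH.symm hxp) with h' | h'
    exacts [h.vx h'.symm, h.xy h']
  have pc : c ≠ p := by
    rintro rfl
    rcases (h.nc _).1 (hH.symm hxp) with h' | h'
    exacts [h.vx h'.symm, h.xz h']
  have nx : ∀ w, H x w ≠ 0 → w = a ∨ w = p :=
    fun w => eq_or_eq_of_card_le pa (hH.symm ax) hxp hx.le
  have ny : ∀ w, H y w ≠ 0 → w = b ∨ w = p :=
    fun w => eq_or_eq_of_card_le pb (hH.symm hby) (hH.symm hpy) hy.le
  have zv : ∀ w, w ≠ a → w ≠ b → w ≠ c → H w v = 0 := by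
    intro w h1 h2 h3
    by_contra h0
    rcases (h.nv w).1 (hH.symm h0) with h' | h' | h' <;> contradiction
  have za : ∀ w, w ≠ v → w ≠ x → H w a = 0 := by
    intro w h1 h2
    by_contra h0
    rcases (h.na w).1 (hH.symm h0) with h' | h' <;> contradiction
  have zb : ∀ w, w ≠ v → w ≠ y → H w b = 0 := by
    intro w h1 h2
    by_contra h0
    rcases (h.nb w).1 (hH.symm h0) with h' | h' <;> contradiction
  have zx : ∀ w, w ≠ a → w ≠ p → H w x = 0 := by
    intro w h1 h2
    by_contra h0
    rcases nx w (hH.symm h0) with h' | h' <;> contradiction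
  have zy : ∀ w, w ≠ b → w ≠ p → H w y = 0 := by
    intro w h1 h2
    by_contra h0
    rcases ny w (hH.symm h0) with h' | h' <;> contradiction
  have ne_of : ∀ {w w'}, col w ≠ col w' → w ≠ w' := fun h h' => h (congrArg col h')
  have ka := hH.col_ne va
  have kb := hH.col_ne vb
  have kc := hH.col_ne vc
  have kx := hH.col_eq va ax
  have ky := hH.col_eq vb hby
  have kp := hH.col_ne hxp
  have va' := ne_of ka
  have vb' := ne_of kb
  have vc' := ne_of kc
  have vp' : v ≠ p := ne_of (by rwa [kx])
  have xa' : x ≠ a := ne_of (by rwa [← kx])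
  have xb' : x ≠ b := ne_of (by rwa [← kx])
  have xc' : x ≠ c := ne_of (by rwa [← kx])
  have xp' : x ≠ p := ne_of kp
  have ya' : y ≠ a := ne_of (by rwa [← ky])
  have yb' : y ≠ b := ne_of (by rwa [← ky])
  have yc' : y ≠ c := ne_of (by rwa [← ky])
  have yp' : y ≠ p := ne_of (by rwa [← ky, kx])
  have ab := h.ab
  have ac := h.ac
  have bc := h.bc
  have vx := h.vx
  have vy := h.vy
  have xy := h.xy
  set t : ℝ := √((1 + √5) / 2) with ht
  have t0 : 0 < t := Real.sqrt_pos.2 (by positivity)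
  have ht2 : 2 * t ^ 2 = 1 + √5 := by
    rw [ht, Real.sq_sqrt (by positivity)]
    ring
  have t4 : (t : ℂ) ^ 4 = (t : ℂ) ^ 2 + 1 := by exact_mod_cast (golden_bounds t0 ht2).1
  -- the vector on the hexagon is even under the reflection that fixes `v` and `p`
  set A : ℂ := (t : ℂ) / 2 with hA
  set B : ℂ := ((t : ℂ) ^ 2 - 1) / 2 with hB
  have B0 : B ≠ 0 := by
    intro hB0
    rw [hB] at hB0
    have h1 : (t : ℂ) ^ 2 = 1 := by linear_combination 2 * hB0
    have h2 : (t : ℂ) ^ 4 = 1 := by linear_combination ((t : ℂ) ^ 2 + 1) * h1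
    rw [h1, h2] at t4
    norm_num at t4
  set f : W → ℂ := Pi.single v 1 + Pi.single a (A * H a v) + Pi.single b (A * H b v) +
    Pi.single x (B * (H x a * H a v)) + Pi.single y (B * (H y b * H b v)) with hf
  have Hf : ∀ w, (H *ᵥ f) w = H w v + H w a * (A * H a v) + H w b * (A * H b v) +
      H w x * (B * (H x a * H a v)) + H w y * (B * (H y b * H b v)) := by
    intro w
    simp only [hf, Matrix.mulVec_add, Pi.add_apply, Matrix.mulVec_single]
    simp
  have fv : f v = 1 := by simp [hf, va', vb', vx, vy]
  have fa : f a = A * H a v := by simp [hf, va'.symm, ab, xa'.symm, ya'.symm]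
  have fb : f b = A * H b v := by simp [hf, vb'.symm, ab.symm, xb'.symm, yb'.symm]
  have fx : f x = B * (H x a * H a v) := by simp [hf, vx.symm, xa', xb', xy]
  have fy : f y = B * (H y b * H b v) := by simp [hf, vy.symm, ya', yb', xy.symm]
  have f0 : ∀ w, w ≠ v → w ≠ a → w ≠ b → w ≠ x → w ≠ y → f w = 0 := by
    intro w h1 h2 h3 h4 h5
    simp [hf, h1, h2, h3, h4, h5]
  have sva := hH.mul_symm va
  have svb := hH.mul_symm vb
  have sax := hH.mul_symm ax
  have sby := hH.mul_symm hby
  have sxp := hH.mul_symm hxp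
  refine hH.not_isTailVector t0 ht2 xy (hH.symm hxp) hpy _ v c f le_rfl
    ⟨h.core_c, hH.symm vc, by rw [fv]; exact Or.inl rfl, f0 c vc'.symm ac.symm bc.symm xc'.symm
      yc'.symm, ?_, ?_, vx, vy, ?_, ?_⟩
  · rw [fx]
    exact mul_ne_zero B0 (mul_ne_zero (hH.symm ax) (hH.symm va))
  · rw [fy]
    exact mul_ne_zero B0 (mul_ne_zero (hH.symm hby) (hH.symm vb))
  · intro w
    rw [Hf, fv]
    by_cases w1 : w = v
    · subst w1
      rw [if_pos rfl, if_neg vc', hH.eq_zero_of_col_eq rfl, zx w va' vp', zy w vb' vp', fv]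
      linear_combination A * sva + A * svb
    by_cases w2 : w = a
    · subst w2
      rw [if_neg va'.symm, if_neg ac, hH.eq_zero_of_col_eq rfl, zb w va'.symm ya'.symm,
        zy w ab pa, fa]
      linear_combination B * H w v * sax - H w v / 2 * t4
    by_cases w3 : w = b
    · subst w3
      rw [if_neg vb'.symm, if_neg bc, hH.eq_zero_of_col_eq rfl, za w vb'.symm xb'.symm,
        zx w ab.symm pb, fb]
      linear_combination B * H w v * sby - H w v / 2 * t4
    by_cases w4 : w = x
    · subst w4
      rw [if_neg vx.symm, if_neg xc', zv w xa' xb' xc', zb w vx.symm xy,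
        hH.eq_zero_of_col_eq rfl, zy w xb' xp', fx]
      linear_combination -(t * H w a * H a v) / 2 * t4
    by_cases w5 : w = y
    · subst w5
      rw [if_neg vy.symm, if_neg yc', zv w ya' yb' yc', za w vy.symm xy.symm,
        hH.eq_zero_of_col_eq rfl, zx w ya' yp', fy]
      linear_combination -(t * H w b * H b v) / 2 * t4
    rw [f0 w w1 w2 w3 w4 w5, if_neg w1, za w w1 w4, zb w w1 w5]
    by_cases w6 : w = p
    · subst w6
      rw [if_neg pc.symm, zv w pa.symm pb.symm pc.symm]
      linear_combination B * (H w x * H x a * H a v) * hw -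
        B * (H w y * H y b * H b v) * (sva * (H a x * H x a) * (H x w * H w x) +
          sax * (H x w * H w x) + sxp)
    · rw [zx w w2 w6, zy w w3 w6]
      by_cases w7 : w = c
      · subst w7
        rw [if_pos rfl]
        ring
      · rw [if_neg w7, zv w w2 w3 w7]
        ring
  · intro w w' hw1 hw2
    have fne : ∀ {w}, (w = v ∨ w = a ∨ w = b ∨ w = x ∨ w = y) → f w ≠ 0 := by
      rintro w (rfl | rfl | rfl | rfl | rfl)
      · rw [fv]
        exact one_ne_zero
      · rw [fa]
        exact mul_ne_zero (by rw [hA]; simpa using t0.ne') (hH.symm va)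
      · rw [fb]
        exact mul_ne_zero (by rw [hA]; simpa using t0.ne') (hH.symm vb)
      · rw [fx]
        exact mul_ne_zero B0 (mul_ne_zero (hH.symm ax) (hH.symm va))
      · rw [fy]
        exact mul_ne_zero B0 (mul_ne_zero (hH.symm hby) (hH.symm vb))
    have : w = v ∨ w = a ∨ w = b ∨ w = x ∨ w = y := by
      by_contra! h'
      exact hw1 (f0 w h'.1 h'.2.1 h'.2.2.1 h'.2.2.2.1 h'.2.2.2.2)
    rcases this with rfl | rfl | rfl | rfl | rfl
    · rcases (h.nv w').1 hw2 with h' | h' | h'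
      · exact Or.inl (fne (by simp [h']))
      · exact Or.inl (fne (by simp [h']))
      · exact Or.inr (Or.inr ⟨rfl, h'⟩)
    · rcases (h.na w').1 hw2 with h' | h' <;> exact Or.inl (fne (by simp [h']))
    · rcases (h.nb w').1 hw2 with h' | h' <;> exact Or.inl (fne (by simp [h']))
    · rcases nx w' hw2 with h' | h'
      · exact Or.inl (fne (by simp [h']))
      · exact Or.inr (Or.inl h')
    · rcases ny w' hw2 with h' | h'
      · exact Or.inl (fne (by simp [h']))
      · exact Or.inr (Or.inl h')

end AdmissibleGain

/-! ### The components of graphs within the bound -/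

namespace MixedGraph

theorem mStar_hMatrix_apply (u v : Fin 10) :
    mStar.hMatrix u v = if (u, v) ∈ mStarArcs then Complex.I
      else if (v, u) ∈ mStarArcs then -Complex.I else 0 := by
  classical
  have h1 : mStar.Arc u v ↔ (u, v) ∈ mStarArcs := Iff.rfl
  have h2 : mStar.Arc v u ↔ (v, u) ∈ mStarArcs := Iff.rfl
  have h3 : mStar.graph.Adj u v ↔ u ≠ v ∧ ((u, v) ∈ mStarArcs ∨ (v, u) ∈ mStarArcs) :=
    SimpleGraph.fromRel_adj _ _ _
  simp only [hMatrix, Matrix.of_apply, h1, h2, h3]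
  split_ifs <;> first | rfl | tauto

theorem mStar_hMatrix_eq_zero_iff (u v : Fin 10) :
    mStar.hMatrix u v = 0 ↔ (u, v) ∉ mStarArcs ∧ (v, u) ∉ mStarArcs := by
  rw [mStar_hMatrix_apply]
  split_ifs <;> simp_all

/-- The vertex `9` is not needed to tell the vertices of `mStar` apart by their neighbourhoods. -/
theorem exists_mStarArcs_separating : ∀ i j : Fin 10, i ≠ j → ∃ k : Fin 10, k ≠ 9 ∧
    ¬ (((k, i) ∉ mStarArcs ∧ (i, k) ∉ mStarArcs) ↔
      ((k, j) ∉ mStarArcs ∧ (j, k) ∉ mStarArcs)) := by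
  decide

end MixedGraph

/-- The vertices `s i` for `i ∈ A` form a union of components of the graph of `H`, and up to the
switching `D` they span the subgraph of `mStar` induced by `A`. -/
structure IsMStarCopy {W : Type*} (H : Matrix W W ℂ) (col : W → Bool) (A : Finset (Fin 10))
    (s : Fin 10 → W) (D : Fin 10 → ℂ) : Prop where
  mem : ∀ i, i ≠ 9 → i ∈ A
  unit : ∀ i ∈ A, IsGaussUnit (D i)
  injOn : ∀ i ∈ A, ∀ j ∈ A, s i = s j → i = j
  apply : ∀ i ∈ A, ∀ j ∈ A,
    H (s i) (s j) = starRingEnd ℂ (D i) * MixedGraph.mStar.hMatrix i j * D j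
  closed : ∀ i ∈ A, ∀ w, H (s i) w ≠ 0 → ∃ j ∈ A, s j = w
  col : ∀ i ∈ A, col (s i) = col (s 0) ↔ i < 4

namespace AdmissibleGain

variable {W : Type*} [Fintype W] {H : Matrix W W ℂ} {col : W → Bool}

/-- The switching that turns a subdivided `K₄` (with possibly the vertex `r` deleted) all of whose
hexagons are negative into the corresponding induced subgraph of `mStar`. -/
theorem isMStarCopy (hH : AdmissibleGain H col) {v a b c x y z p q r : W}
    (h : IsHub H v a b c x y z) {A : Finset (Fin 10)} (hA : ∀ i, i ≠ 9 → i ∈ A)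
    (nx : ∀ w, H x w ≠ 0 → w = a ∨ w = p ∨ w = q)
    (ny : ∀ w, H y w ≠ 0 → w = b ∨ w = p ∨ (9 ∈ A ∧ w = r))
    (nz : ∀ w, H z w ≠ 0 → w = c ∨ w = q ∨ (9 ∈ A ∧ w = r))
    (np : ∀ w, H p w ≠ 0 ↔ w = x ∨ w = y) (nq : ∀ w, H q w ≠ 0 ↔ w = x ∨ w = z)
    (nr : 9 ∈ A → ∀ w, H r w ≠ 0 ↔ w = y ∨ w = z)
    (hp : H v a * H a x * (H x p * H p y) * (H y b * H b v) = -1)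
    (hq : H v a * H a x * (H x q * H q z) * (H z c * H c v) = -1)
    (hr : 9 ∈ A → H v b * H b y * (H y r * H r z) * (H z c * H c v) = -1) :
    ∃ s D, IsMStarCopy H col A s D := by
  have av := (h.na v).2 (by simp)
  have bv := (h.nb v).2 (by simp)
  have cv := (h.nc v).2 (by simp)
  have ax := (h.na x).2 (by simp)
  have hby := (h.nb y).2 (by simp)
  have cz := (h.nc z).2 (by simp)
  have px := (np x).2 (by simp)
  have py := (np y).2 (by simp)
  have qx := (nq x).2 (by simp)
  have qz := (nq z).2 (by simp)
  have vx := h.vx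
  have vy := h.vy
  have vz := h.vz
  have xy := h.xy
  have xz := h.xz
  have yz := h.yz
  have kx := hH.col_eq (hH.symm av) ax
  have ky := hH.col_eq (hH.symm bv) hby
  have kz := hH.col_eq (hH.symm cv) cz
  have ka := hH.col_ne av
  have kb := hH.col_ne bv
  have kc := hH.col_ne cv
  have kp := hH.col_ne px
  have kq := hH.col_ne qx
  have zero : ∀ {w w' : W}, H w w' = 0 → H w' w = 0 := fun {w w'} h0 => by
    rw [← hH.conj_apply, h0, map_zero]
  have z1 : H y a = 0 := zero (not_not.1 fun h0 => by simpa [vy.symm, xy.symm] using (h.na y).1 h0)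
  have z2 : H z a = 0 := zero (not_not.1 fun h0 => by simpa [vz.symm, xz.symm] using (h.na z).1 h0)
  have z3 : H x b = 0 := zero (not_not.1 fun h0 => by simpa [vx.symm, xy] using (h.nb x).1 h0)
  have z4 : H z b = 0 := zero (not_not.1 fun h0 => by simpa [vz.symm, yz.symm] using (h.nb z).1 h0)
  have z5 : H x c = 0 := zero (not_not.1 fun h0 => by simpa [vx.symm, xz] using (h.nc x).1 h0)
  have z6 : H y c = 0 := zero (not_not.1 fun h0 => by simpa [vy.symm, yz] using (h.nc y).1 h0)
  have z7 : H v p = 0 := zero (not_not.1 fun h0 => by simpa [vx, vy] using (np v).1 h0)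
  have z8 : H z p = 0 := zero (not_not.1 fun h0 => by simpa [xz.symm, yz.symm] using (np z).1 h0)
  have z9 : H v q = 0 := zero (not_not.1 fun h0 => by simpa [vx, vz] using (nq v).1 h0)
  have z10 : H y q = 0 := zero (not_not.1 fun h0 => by simpa [xy.symm, yz] using (nq y).1 h0)
  have z11 : 9 ∈ A → H v r = 0 := fun h9 =>
    zero (not_not.1 fun h0 => by simpa [vy, vz] using (nr h9 v).1 h0)
  have z12 : 9 ∈ A → H x r = 0 := fun h9 =>
    zero (not_not.1 fun h0 => by simpa [xy, xz] using (nr h9 x).1 h0)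
  have sav := hH.mul_symm av
  have sbv := hH.mul_symm bv
  have scv := hH.mul_symm cv
  have sax := hH.mul_symm ax
  have sby := hH.mul_symm hby
  have scz := hH.mul_symm cz
  have spy := hH.mul_symm py
  have sqz := hH.mul_symm qz
  have gav := hH.isGaussUnit (hH.symm av)
  have gbv := hH.isGaussUnit (hH.symm bv)
  have gcv := hH.isGaussUnit (hH.symm cv)
  have gax := hH.isGaussUnit ax
  have gby := hH.isGaussUnit hby
  have gcz := hH.isGaussUnit cz
  have gI : IsGaussUnit Complex.I := Or.inr (Or.inr (Or.inl rfl))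
  have gI' : IsGaussUnit (-Complex.I) := Or.inr (Or.inr (Or.inr rfl))
  have g1 : IsGaussUnit (-1) := Or.inr (Or.inl rfl)
  have I2 := Complex.I_mul_I
  set s : Fin 10 → W := ![v, x, y, z, a, b, c, p, q, r] with hs
  set D : Fin 10 → ℂ := ![1, -1 * (H v a * H a x), -1 * (H v b * H b y), -1 * (H v c * H c z),
    -Complex.I * H v a, -Complex.I * H v b, -Complex.I * H v c,
    Complex.I * (H v a * H a x * H x p), Complex.I * (H v a * H a x * H x q),
    Complex.I * (H v b * H b y * H y r)] with hD
  have ent : ∀ i j : Fin 10, i < 4 → 4 ≤ j → j ∈ A →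
      H (s i) (s j) = starRingEnd ℂ (D i) * MixedGraph.mStar.hMatrix i j * D j := by
    intro i j hi hj hjA
    rw [MixedGraph.mStar_hMatrix_apply]
    fin_cases i <;> fin_cases j <;>
      first
      | exact absurd hi (by decide)
      | exact absurd hj (by decide)
      | (simp only [hs, hD, MixedGraph.mStarArcs]
         simp [hH.conj_apply, z1, z2, z3, z4, z5, z6, z7, z8, z9, z10,
           -mul_eq_mul_left_iff, -mul_eq_mul_right_iff])
    · linear_combination H v a * I2
    · linear_combination H v b * I2
    · linear_combination H v c * I2
    · exact z11 hjA
    · linear_combination H a v * H v a * H x a * I2 - H x a * sav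
    · linear_combination H a v * H v a * H x a * H a x * H x p * I2 -
        H x p * (H x a * H a x * sav + sax)
    · linear_combination H a v * H v a * H x a * H a x * H x q * I2 -
        H x q * (H x a * H a x * sav + sax)
    · exact z12 hjA
    · linear_combination H b v * H v b * H y b * I2 - H y b * sbv
    · linear_combination -(H v a * H a x * H x p * H y b * H b v) * (I2 + spy) + H y p * hp
    · linear_combination H b v * H v b * H y b * H b y * H y r * I2 -
        H y r * (H y b * H b y * sbv + sby)
    · linear_combination H c v * H v c * H z c * I2 - H z c * scv
    · linear_combination -(H v a * H a x * H x q * H z c * H c v) * (I2 + sqz) + H z q * hq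
    · linear_combination -(H v b * H b y * H y r * H z c * H c v) *
        (I2 + hH.mul_symm ((nr hjA z).2 (by simp))) + H z r * hr hjA
  have colA : ∀ i ∈ A, col (s i) = col v ↔ i < 4 := by
    intro i hi
    fin_cases i <;> simp [hs, ← kx, ← ky, ← kz, ka, kb, kc]
    all_goals first | exact (kx ▸ kp) | exact (kx ▸ kq) | skip
    have := hH.col_ne ((nr hi y).2 (by simp))
    rwa [← ky] at this
  have colz : ∀ i j : Fin 10, (i < 4 ↔ j < 4) → MixedGraph.mStar.hMatrix i j = 0 := by
    intro i j
    rw [MixedGraph.mStar_hMatrix_eq_zero_iff]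
    revert i j
    decide
  have entA : ∀ i ∈ A, ∀ j ∈ A,
      H (s i) (s j) = starRingEnd ℂ (D i) * MixedGraph.mStar.hMatrix i j * D j := by
    intro i hi j hj
    by_cases hij : i < 4 ↔ j < 4
    · rw [colz i j hij, mul_zero, zero_mul]
      refine hH.eq_zero_of_col_eq ?_
      have h1 := colA i hi
      have h2 := colA j hj
      revert h1 h2 hij
      generalize col (s i) = e1
      generalize col (s j) = e2
      generalize col v = e3
      by_cases c1 : i < 4 <;> by_cases c2 : j < 4 <;> cases e1 <;> cases e2 <;> cases e3 <;>
        simp [c1, c2]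
    · by_cases h4 : i < 4
      · exact ent i j h4 (by simpa [h4] using hij) hj
      · have h4' : j < 4 := by simpa [h4] using hij
        have := congrArg (starRingEnd ℂ) (ent j i h4' (not_lt.1 h4) hi)
        have e := MixedGraph.mStar.hMatrix_isHermitian.apply i j
        rw [hH.conj_apply, map_mul, map_mul, Complex.conj_conj] at this
        rw [this, ← e]
        simp only [RCLike.star_def]
        ring
  have gD : ∀ i ∈ A, IsGaussUnit (D i) := by
    intro i hi
    have gva := hH.isGaussUnit (hH.symm av)
    have gvb := hH.isGaussUnit (hH.symm bv)
    have gvc := hH.isGaussUnit (hH.symm cv)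
    fin_cases i
    · exact Or.inl rfl
    · exact g1.mul (gva.mul gax)
    · exact g1.mul (gvb.mul gby)
    · exact g1.mul (gvc.mul gcz)
    · exact gI'.mul gva
    · exact gI'.mul gvb
    · exact gI'.mul gvc
    · exact gI.mul ((gva.mul gax).mul (hH.isGaussUnit (hH.symm px)))
    · exact gI.mul ((gva.mul gax).mul (hH.isGaussUnit (hH.symm qx)))
    · exact gI.mul ((gvb.mul gby).mul (hH.isGaussUnit (hH.symm ((nr hi y).2 (by simp)))))
  refine ⟨s, D, hA, gD, ?_, entA, ?_, colA⟩
  · intro i hi j hj hij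
    by_contra hne
    obtain ⟨k, hk, hkk⟩ := MixedGraph.exists_mStarArcs_separating i j hne
    refine hkk ?_
    rw [← MixedGraph.mStar_hMatrix_eq_zero_iff, ← MixedGraph.mStar_hMatrix_eq_zero_iff]
    have h1 := entA k (hA k hk) i hi
    have h2 := entA k (hA k hk) j hj
    have n0 : starRingEnd ℂ (D k) ≠ 0 := (gD k (hA k hk)).star.ne_zero
    rw [hij, h2] at h1
    constructor <;> intro h0 <;> rw [h0] at h1 <;>
      simpa [n0, (gD i hi).ne_zero, (gD j hj).ne_zero, (gD k (hA k hk)).ne_zero] using h1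
  · intro i hi w hw
    have m : ∀ j : Fin 10, j ≠ 9 → s j = w → ∃ j ∈ A, s j = w := fun j hj h => ⟨j, hA j hj, h⟩
    fin_cases i
    · rcases (h.nv w).1 hw with rfl | rfl | rfl
      exacts [m 4 (by decide) rfl, m 5 (by decide) rfl, m 6 (by decide) rfl]
    · rcases nx w hw with rfl | rfl | rfl
      exacts [m 4 (by decide) rfl, m 7 (by decide) rfl, m 8 (by decide) rfl]
    · rcases ny w hw with rfl | rfl | ⟨h9, rfl⟩
      exacts [m 5 (by decide) rfl, m 7 (by decide) rfl, ⟨9, h9, rfl⟩]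
    · rcases nz w hw with rfl | rfl | ⟨h9, rfl⟩
      exacts [m 6 (by decide) rfl, m 8 (by decide) rfl, ⟨9, h9, rfl⟩]
    · rcases (h.na w).1 hw with rfl | rfl
      exacts [m 0 (by decide) rfl, m 1 (by decide) rfl]
    · rcases (h.nb w).1 hw with rfl | rfl
      exacts [m 0 (by decide) rfl, m 2 (by decide) rfl]
    · rcases (h.nc w).1 hw with rfl | rfl
      exacts [m 0 (by decide) rfl, m 3 (by decide) rfl]
    · rcases (np w).1 hw with rfl | rfl
      exacts [m 1 (by decide) rfl, m 2 (by decide) rfl]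
    · rcases (nq w).1 hw with rfl | rfl
      exacts [m 1 (by decide) rfl, m 3 (by decide) rfl]
    · rcases (nr hi w).1 hw with rfl | rfl
      exacts [m 2 (by decide) rfl, m 3 (by decide) rfl]

/-- The common neighbour `p` of the second neighbours `x` and `y` of a hub. -/
theorem exists_common_nbr (hH : AdmissibleGain H col) {v a b c x y z : W}
    (h : IsHub H v a b c x y z) (hw : hexWeight H v a b x y = -1) :
    ∃ p, H x p ≠ 0 ∧ H p y ≠ 0 ∧ H v a * H a x * (H x p * H p y) * (H y b * H b v) = -1 ∧
      a ≠ p ∧ b ≠ p ∧ InCore H p := by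
  rcases hH.hexWeight_cases h with ⟨h0, -⟩ | ⟨p, hxp, hpy, -, hp, -⟩
  · rw [h0] at hw
    norm_num at hw
  refine ⟨p, hxp, hpy, hp ▸ hw, ?_, ?_, h.core_x.of_two h.core_y h.xy (hH.symm hxp) hpy⟩
  · rintro rfl
    rcases (h.na _).1 hpy with h' | h'
    exacts [h.vy h'.symm, h.xy h'.symm]
  · rintro rfl
    rcases (h.nb _).1 (hH.symm hxp) with h' | h'
    exacts [h.vx h'.symm, h.xy h']

/-- The third neighbour `p` of a branch vertex `x` has degree `2`. -/
theorem nbrs_eq (hH : AdmissibleGain H col) {x y p q r : W} (hpq : p ≠ q) (hpr : p ≠ r)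
    (hqr : q ≠ r) (hp : H x p ≠ 0) (hq : H x q ≠ 0) (hr : H x r ≠ 0)
    (cq : InCore H q) (cr : InCore H r) (hxy : x ≠ y) (hpy : H p y ≠ 0) (w : W) :
    H p w ≠ 0 ↔ w = x ∨ w = y := by
  refine ⟨eq_or_eq_of_card_le hxy (hH.symm hp) hpy
    (hH.card_nbr_le_two hpq hpr hqr hp hq hr cq cr), ?_⟩
  rintro (rfl | rfl)
  exacts [hH.symm hp, hpy]

/-- The component of a branch vertex, if some second neighbour of it has degree `3`. -/
theorem exists_isMStarCopy_of_card_three (hH : AdmissibleGain H col) {v a b c x y z : W}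
    (h : IsHub H v a b c x y z) (hx : (gainNbrs H x).card = 3) :
    ∃ A s D, IsMStarCopy H col A s D := by
  have h' : IsHub H v a c b x z y := h.rotate.rotate.swap
  have wxy := hH.hexWeight_of_card_three h hx
  have wxz := hH.hexWeight_of_card_three h' hx
  obtain ⟨p, xp, py, hp, ap, bp, cp⟩ := hH.exists_common_nbr h wxy
  obtain ⟨q, xq, qz, hq, aq, cq', cq⟩ := hH.exists_common_nbr h' wxz
  have ax := (h.na x).2 (by simp)
  have pq : p ≠ q := by
    rintro rfl
    -- three paths of length `3` from `v` to `p` close three hexagons, whose weights, traversed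
    -- cyclically, have product `1`: two weights `-1` force the third to be `1`
    rcases hH.hexWeight_cases h.rotate with ⟨-, h0⟩ | ⟨p', -, -, hu, hp', -⟩
    · exact qz (h0 p (hH.symm py))
    · obtain rfl := hu p (hH.symm py) qz
      refine hH.hexWeight_ne_one h.rotate ?_
      rw [hp']
      have sva := hH.mul_symm ((h.nv a).2 (by simp))
      have e := congrArg (starRingEnd ℂ) hp
      simp only [map_mul, hH.conj_apply, map_neg, map_one] at e
      have sax := hH.mul_symm ax
      have sxp := hH.mul_symm xp
      linear_combination -(H v b * H b y * H y p * H p z * H z c * H c v) *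
        (sva * (H a x * H x a) * (H x p * H p x) + sax * (H x p * H p x) + sxp) +
        (H v a * H a x * H x p * H p z * H z c * H c v) * e - hq
  have nx : ∀ w, H x w ≠ 0 → w = a ∨ w = p ∨ w = q :=
    fun w => eq_or_eq_or_eq_of_card_le ap aq pq (hH.symm ax) xp xq hx.le
  have np := hH.nbrs_eq ap.symm pq aq xp (hH.symm ax) xq h.core_a cq h.xy py
  have nq := hH.nbrs_eq aq.symm pq.symm ap xq (hH.symm ax) xp h.core_a cp h.xz qz
  have hby := (h.nb y).2 (by simp)
  have cz := (h.nc z).2 (by simp)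
  by_cases hyz : (gainNbrs H y).card = 2 ∧ (gainNbrs H z).card = 2
  · refine ⟨univ.erase 9, hH.isMStarCopy h (r := v) (by simp) nx ?_ ?_ np nq (by simp) hp hq
      (by simp)⟩
    · intro w hw
      rcases eq_or_eq_of_card_le bp (hH.symm hby) (hH.symm py) hyz.1.le hw with h1 | h1 <;>
        simp [h1]
    · intro w hw
      rcases eq_or_eq_of_card_le cq' (hH.symm cz) (hH.symm qz) hyz.2.le hw with h1 | h1 <;>
        simp [h1]
  · have wyz : hexWeight H v b c y z = -1 := by
      rcases hH.hub_card h.rotate with hy | hy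
      · rcases hH.hub_card h.rotate.rotate with hz | hz
        · exact absurd ⟨hy, hz⟩ hyz
        · have := hH.hexWeight_of_card_three h.rotate.swap hz
          simpa using hH.hexWeight_swap (ε := -1) (by simpa using this)
      · exact hH.hexWeight_of_card_three h.rotate hy
    obtain ⟨r, yr, rz, hr, br, cr', cr⟩ := hH.exists_common_nbr h.rotate wyz
    have pr : p ≠ r := by
      rintro rfl
      rcases (np _).1 rz with h1 | h1
      exacts [h.xz h1.symm, h.yz h1.symm]
    have qr : q ≠ r := by
      rintro rfl
      rcases (nq _).1 (hH.symm yr) with h1 | h1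
      exacts [h.xy h1.symm, h.yz h1]
    have nr := hH.nbrs_eq br.symm pr.symm bp yr (hH.symm hby) (hH.symm py) h.core_b cp h.yz rz
    refine ⟨univ, hH.isMStarCopy h (r := r) (by simp) nx ?_ ?_ np nq (fun _ => nr) hp hq
      (fun _ => hr)⟩
    · intro w hw
      have := eq_or_eq_or_eq_of_card_le bp br pr (hH.symm hby) (hH.symm py) yr
        (hH.card_le_three h.xy.symm (hH.symm py) (hH.symm xp)) hw
      simpa using this
    · intro w hw
      have := eq_or_eq_or_eq_of_card_le cq' cr' qr (hH.symm cz) (hH.symm qz) (hH.symm rz)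
        (hH.card_le_three h.xz.symm (hH.symm qz) (hH.symm xq)) hw
      simpa using this

/-- The component of a branch vertex of the `2`-core is `mStar` or `mStar` minus a vertex of
degree `2`, up to switching. -/
theorem exists_isMStarCopy (hH : AdmissibleGain H col) {v a b c : W} (hab : a ≠ b) (hac : a ≠ c)
    (hbc : b ≠ c) (ha : H v a ≠ 0) (hb : H v b ≠ 0) (hc : H v c ≠ 0) (ca : InCore H a)
    (cb : InCore H b) (cc : InCore H c) : ∃ A s D, IsMStarCopy H col A s D := by
  obtain ⟨x, y, z, h⟩ := hH.exists_isHub hab hac hbc ha hb hc ca cb cc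
  rcases hH.hub_card h with hx | hx
  · rcases hH.hub_card h.rotate with hy | hy
    · rcases hH.hub_card h.rotate.rotate with hz | hz
      · have h' : IsHub H v a c b x z y := h.rotate.rotate.swap
        rcases hH.exists_hexWeight_eq_neg_one h with hw | hw | hw
        · exact absurd hw (hH.hexWeight_ne_neg_one h hx hy)
        · exact absurd hw (hH.hexWeight_ne_neg_one h' hx hz)
        · exact absurd hw (hH.hexWeight_ne_neg_one h.rotate hy hz)
      · exact hH.exists_isMStarCopy_of_card_three h.rotate.rotate hz
    · exact hH.exists_isMStarCopy_of_card_three h.rotate hy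
  · exact hH.exists_isMStarCopy_of_card_three h hx

end AdmissibleGain

/-! ### Cycles and the `2`-core -/

namespace SimpleGraph

variable {V : Type*} {G : SimpleGraph V}

theorem Walk.support_subset_of_closed {S T : Set V}
    (hT : ∀ x ∈ T, ∀ y ∈ S, G.Adj x y → y ∈ T) {u v : V} (r : G.Walk u v) (hu : u ∈ T)
    (hr : ∀ x ∈ r.support, x ∈ S) : ∀ x ∈ r.support, x ∈ T := by
  induction r with
  | nil => simpa using hu
  | cons h r ih =>
    intro x hx
    rw [Walk.support_cons, List.mem_cons] at hx
    rcases hx with rfl | hx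
    · exact hu
    · refine ih (hT _ hu _ ?_ h) (fun y hy => ?_) x hx
      · exact hr _ (by simp)
      · exact hr y (by simp [hy])

theorem Connected.mem_of_closed (hG : G.Connected)
    {T : Set V} (hT : ∀ x ∈ T, ∀ y, G.Adj x y → y ∈ T) {u : V} (hu : u ∈ T) (v : V) : v ∈ T := by
  obtain ⟨r⟩ := hG.preconnected u v
  exact r.support_subset_of_closed (S := Set.univ) (fun x hx y _ h => hT x hx y h) hu
    (fun _ _ => trivial) v r.end_mem_support

/-- In a vertex set `S` without three neighbours in `S` of one vertex, the edges of `S` at a cycle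
belong to the cycle. -/
theorem Walk.IsCycle.toSubgraph_adj_of_mem {S : Set V}
    (h3 : ∀ v ∈ S, ∀ a ∈ S, ∀ b ∈ S, ∀ c ∈ S, a ≠ b → a ≠ c → b ≠ c → G.Adj v a → G.Adj v b →
      ¬ G.Adj v c) {u : V} {p : G.Walk u u} (hp : p.IsCycle) (hS : ∀ x ∈ p.support, x ∈ S) :
    ∀ w ∈ p.support, ∀ w' ∈ S, G.Adj w w' → p.toSubgraph.Adj w w' := by
  intro w hw w' hw' hadj
  obtain ⟨a, b, hab, hN⟩ := Set.ncard_eq_two.1 (hp.ncard_neighborSet_toSubgraph_eq_two hw)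
  have ha : p.toSubgraph.Adj w a := by
    rw [← Subgraph.mem_neighborSet, hN]
    simp
  have hb : p.toSubgraph.Adj w b := by
    rw [← Subgraph.mem_neighborSet, hN]
    simp
  by_cases h1 : a = w'
  · exact h1 ▸ ha
  by_cases h2 : b = w'
  · exact h2 ▸ hb
  exact absurd hadj (h3 w (hS w hw) a (hS a (p.mem_verts_toSubgraph.1 ha.snd_mem)) b
    (hS b (p.mem_verts_toSubgraph.1 hb.snd_mem)) w' hw' hab h1 h2 ha.adj_sub hb.adj_sub)

theorem Walk.IsCycle.exists_two_adj {u w : V} {p : G.Walk u u} (hp : p.IsCycle)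
    (hw : w ∈ p.support) :
    ∃ a ∈ p.support, ∃ b ∈ p.support, a ≠ b ∧ G.Adj w a ∧ G.Adj w b := by
  obtain ⟨a, b, hab, hN⟩ := Set.ncard_eq_two.1 (hp.ncard_neighborSet_toSubgraph_eq_two hw)
  have ha : p.toSubgraph.Adj w a := by
    rw [← Subgraph.mem_neighborSet, hN]
    simp
  have hb : p.toSubgraph.Adj w b := by
    rw [← Subgraph.mem_neighborSet, hN]
    simp
  exact ⟨a, p.mem_verts_toSubgraph.1 ha.snd_mem, b, p.mem_verts_toSubgraph.1 hb.snd_mem, hab,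
    ha.adj_sub, hb.adj_sub⟩

/-- The `2`-core of a connected graph with two cycles has a branch vertex. The set `S` consists of
the two cycles and a path between them. -/
theorem Connected.exists_branch (hG : G.Connected) {u v : V} {p : G.Walk u u} {q : G.Walk v v}
    (hp : p.IsCycle) (hq : q.IsCycle) (hpq : p.toSubgraph ≠ q.toSubgraph) :
    ∃ S : Set V, (∀ w ∈ S, ∃ a ∈ S, ∃ b ∈ S, a ≠ b ∧ G.Adj w a ∧ G.Adj w b) ∧
      ∃ w ∈ S, ∃ a ∈ S, ∃ b ∈ S, ∃ c ∈ S, a ≠ b ∧ a ≠ c ∧ b ≠ c ∧ G.Adj w a ∧ G.Adj w b ∧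
        G.Adj w c := by
  obtain ⟨r, hr⟩ := hG.exists_isPath u v
  set S : Set V := {x | x ∈ p.support ∨ x ∈ q.support ∨ x ∈ r.support} with hS
  have pS : ∀ x ∈ p.support, x ∈ S := fun x hx => Or.inl hx
  have qS : ∀ x ∈ q.support, x ∈ S := fun x hx => Or.inr (Or.inl hx)
  have rS : ∀ x ∈ r.support, x ∈ S := fun x hx => Or.inr (Or.inr hx)
  refine ⟨S, ?_, ?_⟩
  · have hp' : ∀ w ∈ p.support, ∃ a ∈ S, ∃ b ∈ S, a ≠ b ∧ G.Adj w a ∧ G.Adj w b := by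
      intro w hw
      obtain ⟨a, ha, b, hb, h⟩ := hp.exists_two_adj hw
      exact ⟨a, pS a ha, b, pS b hb, h⟩
    have hq' : ∀ w ∈ q.support, ∃ a ∈ S, ∃ b ∈ S, a ≠ b ∧ G.Adj w a ∧ G.Adj w b := by
      intro w hw
      obtain ⟨a, ha, b, hb, h⟩ := hq.exists_two_adj hw
      exact ⟨a, qS a ha, b, qS b hb, h⟩
    rintro w (hw | hw | hw)
    · exact hp' w hw
    · exact hq' w hw
    · obtain ⟨i, rfl, hi⟩ := Walk.mem_support_iff_exists_getVert.1 hw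
      by_cases h0 : i = 0
      · subst h0
        rw [Walk.getVert_zero]
        exact hp' u p.start_mem_support
      by_cases hl : i = r.length
      · subst hl
        rw [Walk.getVert_length]
        exact hq' v q.start_mem_support
      obtain ⟨a, b, hab, hN⟩ := Set.ncard_eq_two.1
        (hr.ncard_neighborSet_toSubgraph_internal_eq_two h0 (by omega))
      have ha : r.toSubgraph.Adj (r.getVert i) a := by
        rw [← Subgraph.mem_neighborSet, hN]
        simp
      have hb : r.toSubgraph.Adj (r.getVert i) b := by
        rw [← Subgraph.mem_neighborSet, hN]
        simp
      exact ⟨a, rS a (r.mem_verts_toSubgraph.1 ha.snd_mem), b,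
        rS b (r.mem_verts_toSubgraph.1 hb.snd_mem), hab, ha.adj_sub, hb.adj_sub⟩
  · by_contra! h3
    have ap := hp.toSubgraph_adj_of_mem h3 pS
    have aq := hq.toSubgraph_adj_of_mem h3 qS
    have cp : ∀ x ∈ {x | x ∈ p.support}, ∀ y ∈ S, G.Adj x y → y ∈ {x | x ∈ p.support} :=
      fun x hx y hy h => p.mem_verts_toSubgraph.1 (ap x hx y hy h).snd_mem
    have cq : ∀ x ∈ {x | x ∈ q.support}, ∀ y ∈ S, G.Adj x y → y ∈ {x | x ∈ q.support} :=
      fun x hx y hy h => q.mem_verts_toSubgraph.1 (aq x hx y hy h).snd_mem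
    have hv : v ∈ p.support :=
      r.support_subset_of_closed cp p.start_mem_support rS v r.end_mem_support
    have hu : u ∈ q.support :=
      r.reverse.support_subset_of_closed cq q.start_mem_support (by simpa using rS) u
        (by simp)
    have hqp := q.support_subset_of_closed cp hv qS
    have hpq' := p.support_subset_of_closed cq hu pS
    refine hpq (Subgraph.ext ?_ ?_)
    · ext x
      rw [Walk.mem_verts_toSubgraph, Walk.mem_verts_toSubgraph]
      exact ⟨hpq' x, hqp x⟩
    · ext x y
      constructor
      · intro h
        exact aq x (hpq' x (p.mem_verts_toSubgraph.1 h.fst_mem)) y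
          (pS y (p.mem_verts_toSubgraph.1 h.snd_mem)) h.adj_sub
      · intro h
        exact ap x (hqp x (q.mem_verts_toSubgraph.1 h.fst_mem)) y
          (qS y (q.mem_verts_toSubgraph.1 h.snd_mem)) h.adj_sub

end SimpleGraph

/-! ### The spectral radius and the Hermitian adjacency matrix -/

namespace MixedGraph

variable {V : Type*}

theorem normSq_mulVec_le [Fintype V] [DecidableEq V] (M : MixedGraph V) (f : V → ℂ) :
    ∑ u, Complex.normSq ((M.hMatrix *ᵥ f) u) ≤
      M.spectralRadius ^ 2 * ∑ u, Complex.normSq (f u) := by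
  have hM := M.hMatrix_isHermitian
  have hn : ∀ g : V → ℂ, ∑ u, Complex.normSq (g u) =
      ∑ i, ‖inner ℂ (hM.eigenvectorBasis i) (WithLp.toLp 2 g)‖ ^ 2 := by
    intro g
    rw [OrthonormalBasis.sum_sq_norm_inner_right, EuclideanSpace.norm_sq_eq]
    exact sum_congr rfl fun u _ => by rw [Complex.normSq_eq_norm_sq]
  have hi : ∀ i, inner ℂ (hM.eigenvectorBasis i) (WithLp.toLp 2 (M.hMatrix *ᵥ f)) =
      (hM.eigenvalues i : ℂ) * inner ℂ (hM.eigenvectorBasis i) (WithLp.toLp 2 f) := by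
    intro i
    have h1 := hM.mulVec_eigenvectorBasis i
    have h2 : star (M.hMatrix *ᵥ (hM.eigenvectorBasis i).ofLp) =
        (hM.eigenvalues i : ℂ) • star (hM.eigenvectorBasis i).ofLp := by
      rw [h1]
      ext w
      simp
    rw [EuclideanSpace.inner_eq_star_dotProduct, EuclideanSpace.inner_eq_star_dotProduct]
    rw [dotProduct_comm, dotProduct_mulVec, ← smul_eq_mul, ← dotProduct_smul, ← h2, star_mulVec,
      hM.eq, dotProduct_comm]
  rw [hn, hn, mul_sum]
  refine sum_le_sum fun i _ => ?_
  rw [hi, norm_mul, mul_pow]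
  refine mul_le_mul_of_nonneg_right ?_ (by positivity)
  rw [Complex.norm_real, Real.norm_eq_abs]
  exact pow_le_pow_left₀ (abs_nonneg _) (le_ciSup (f := fun v => |hM.eigenvalues v|)
    (Set.finite_range _).bddAbove i) 2

theorem spectralRadius_nonneg [Fintype V] [DecidableEq V] (M : MixedGraph V) :
    0 ≤ M.spectralRadius :=
  Real.iSup_nonneg fun _ => abs_nonneg _

theorem spectralRadius_le [Fintype V] [DecidableEq V] (M : MixedGraph V) {c : ℝ} (hc : 0 ≤ c)
    (h : ∀ f : V → ℂ, ∑ u, Complex.normSq ((M.hMatrix *ᵥ f) u) ≤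
      c ^ 2 * ∑ u, Complex.normSq (f u)) : M.spectralRadius ≤ c := by
  refine Real.iSup_le (fun i => ?_) hc
  have hM := M.hMatrix_isHermitian
  have h1 := h (hM.eigenvectorBasis i).ofLp
  rw [hM.mulVec_eigenvectorBasis i] at h1
  have h2 : ∑ u, Complex.normSq ((hM.eigenvectorBasis i).ofLp u) = 1 := by
    have := EuclideanSpace.norm_sq_eq (hM.eigenvectorBasis i)
    rw [hM.eigenvectorBasis.norm_eq_one] at this
    rw [← one_pow 2, this]
    exact sum_congr rfl fun u _ => by rw [Complex.normSq_eq_norm_sq]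
  have h3 : ∀ u, Complex.normSq ((hM.eigenvalues i • (hM.eigenvectorBasis i).ofLp) u) =
      hM.eigenvalues i ^ 2 * Complex.normSq ((hM.eigenvectorBasis i).ofLp u) := by
    intro u
    rw [Pi.smul_apply, Complex.real_smul, map_mul, Complex.normSq_ofReal]
    ring
  simp only [h3, ← mul_sum, h2, mul_one] at h1
  exact abs_le_of_sq_le_sq h1 hc

theorem isGaussUnit_hMatrix (M : MixedGraph V) {u v : V} (h : M.hMatrix u v ≠ 0) :
    IsGaussUnit (M.hMatrix u v) := by
  simp only [hMatrix, Matrix.of_apply] at h ⊢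
  split_ifs at h ⊢ <;> simp_all [IsGaussUnit]

theorem hMatrix_ne_zero_iff (M : MixedGraph V) {u v : V} :
    M.hMatrix u v ≠ 0 ↔ M.graph.Adj u v := by
  simp only [hMatrix, Matrix.of_apply]
  split_ifs with h1 h2 h3
  · simp [M.adj_of_arc h1]
  · simp [(M.adj_of_arc h2).symm]
  · simp [h3]
  · simp [h3]

theorem conj_hMatrix (M : MixedGraph V) (u v : V) :
    starRingEnd ℂ (M.hMatrix u v) = M.hMatrix v u :=
  M.hMatrix_isHermitian.apply v u

theorem negFourCycle_hMatrix_apply (u v : Fin 4) :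
    negFourCycle.hMatrix u v =
      if (u, v) ∈ ({(0, 1), (1, 2)} : Finset (Fin 4 × Fin 4)) then Complex.I
      else if (v, u) ∈ ({(0, 1), (1, 2)} : Finset (Fin 4 × Fin 4)) then -Complex.I
      else if (SimpleGraph.cycleGraph 4).Adj u v then 1 else 0 := by
  have h1 : negFourCycle.Arc u v ↔
    (u, v) ∈ ({(0, 1), (1, 2)} : Finset (Fin 4 × Fin 4)) := Iff.rfl
  have h2 : negFourCycle.Arc v u ↔
    (v, u) ∈ ({(0, 1), (1, 2)} : Finset (Fin 4 × Fin 4)) := Iff.rfl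
  have h3 : negFourCycle.graph.Adj u v ↔ (SimpleGraph.cycleGraph 4).Adj u v := Iff.rfl
  simp only [hMatrix, Matrix.of_apply, h1, h2, h3]

/-- The mixed graph on `W` with underlying graph `G` whose arcs are pulled back along `f`. -/
def restrict {W : Type*} (M : MixedGraph V) (G : SimpleGraph W) (f : W → V) : MixedGraph W where
  graph := G
  Arc i j := G.Adj i j ∧ M.Arc (f i) (f j)
  adj_of_arc h := h.1
  arc_asymm h h' := M.arc_asymm h.2 h'.2

open Classical in
theorem restrict_hMatrix {W : Type*} (M : MixedGraph V) (G : SimpleGraph W) (f : W → V)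
    (h : ∀ i j, G.Adj i j → M.graph.Adj (f i) (f j)) (i j : W) :
    (M.restrict G f).hMatrix i j = if G.Adj i j then M.hMatrix (f i) (f j) else 0 := by
  by_cases hij : G.Adj i j
  · simp [hMatrix, restrict, hij, hij.symm, h i j hij]
  · have hji : ¬ G.Adj j i := fun h => hij h.symm
    simp [hMatrix, restrict, hij, hji]

/-- A mixed graph that is free of the negative `4`-cycle has no `4`-cycle of weight `-1`. -/
theorem IsFree.weight_ne {M : MixedGraph V} (hM : IsFree negFourCycle M) {u u' w w' : V}
    (hu : u ≠ u') (hw : w ≠ w') :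
    M.hMatrix u w * M.hMatrix w u' * M.hMatrix u' w' * M.hMatrix w' u ≠ -1 := by
  intro hprod
  have hne : M.hMatrix u w * M.hMatrix w u' * M.hMatrix u' w' * M.hMatrix w' u ≠ 0 := by
    rw [hprod]
    norm_num
  simp only [mul_ne_zero_iff] at hne
  obtain ⟨⟨⟨h1, h2⟩, h3⟩, h4⟩ := hne
  have g1 := M.isGaussUnit_hMatrix h1
  have g2 := M.isGaussUnit_hMatrix h2
  have g3 := M.isGaussUnit_hMatrix h3
  have a1 := M.hMatrix_ne_zero_iff.1 h1
  have a2 := M.hMatrix_ne_zero_iff.1 h2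
  have a3 := M.hMatrix_ne_zero_iff.1 h3
  have a4 := M.hMatrix_ne_zero_iff.1 h4
  set f : Fin 4 → V := ![u, w, u', w'] with hf
  have hinj : Function.Injective f := by
    have := a1.ne; have := a2.ne; have := a3.ne; have := a4.ne
    intro i j hij
    fin_cases i <;> fin_cases j <;> simp_all
  have hadj : ∀ i j, (SimpleGraph.cycleGraph 4).Adj i j → M.graph.Adj (f i) (f j) := by
    intro i j hij
    fin_cases i <;> fin_cases j <;>
      first
      | exact absurd hij (by decide)
      | exact a1
      | exact a2
      | exact a3
      | exact a4
      | exact a1.symm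
      | exact a2.symm
      | exact a3.symm
      | exact a4.symm
  set d : Fin 4 → ℂ := ![1, -Complex.I * M.hMatrix u w, -1 * (M.hMatrix u w * M.hMatrix w u'),
    -1 * (M.hMatrix u w * M.hMatrix w u' * M.hMatrix u' w')] with hd'
  have hd : ∀ i, IsGaussUnit (d i) := by
    have gI : IsGaussUnit (-Complex.I) := Or.inr (Or.inr (Or.inr rfl))
    have gm : IsGaussUnit (-1) := Or.inr (Or.inl rfl)
    intro i
    fin_cases i
    · exact Or.inl rfl
    · exact gI.mul g1
    · exact gm.mul (g1.mul g2)
    · exact gm.mul ((g1.mul g2).mul g3)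
  refine hM (M.restrict (SimpleGraph.cycleGraph 4) f) ⟨Equiv.refl _, Or.inl ⟨d, hd, ?_⟩⟩
    ⟨⟨f, hinj⟩, ?_⟩
  · intro i j
    change (M.restrict (SimpleGraph.cycleGraph 4) f).hMatrix i j =
      (d i)⁻¹ * negFourCycle.hMatrix i j * d j
    rw [show (d i)⁻¹ = starRingEnd ℂ (d i) from inv_eq_of_mul_eq_one_right
      (hd i).mul_conj]
    have fwd : ∀ i j, i < j → (M.restrict (SimpleGraph.cycleGraph 4) f).hMatrix i j =
        starRingEnd ℂ (d i) * negFourCycle.hMatrix i j * d j := by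
      intro i j hij
      rw [restrict_hMatrix _ _ _ hadj, negFourCycle_hMatrix_apply]
      fin_cases i <;> fin_cases j <;> first | exact absurd hij (by decide) | skip
      · rw [if_pos (by decide), if_pos (by decide)]
        change M.hMatrix u w = starRingEnd ℂ 1 * Complex.I * (-Complex.I * M.hMatrix u w)
        rw [map_one]
        linear_combination M.hMatrix u w * Complex.I_mul_I
      · rw [if_neg (by decide), if_neg (by decide), if_neg (by decide), if_neg (by decide)]
        simp
      · rw [if_pos (by decide), if_neg (by decide), if_neg (by decide), if_pos (by decide)]
        change M.hMatrix u w' = starRingEnd ℂ 1 * 1 *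
          (-1 * (M.hMatrix u w * M.hMatrix w u' * M.hMatrix u' w'))
        have s4 := (M.isGaussUnit_hMatrix h4).mul_conj
        rw [conj_hMatrix] at s4
        rw [map_one]
        linear_combination M.hMatrix u w' * hprod -
          M.hMatrix u w * M.hMatrix w u' * M.hMatrix u' w' * s4
      · rw [if_pos (by decide), if_pos (by decide)]
        change M.hMatrix w u' = starRingEnd ℂ (-Complex.I * M.hMatrix u w) * Complex.I *
          (-1 * (M.hMatrix u w * M.hMatrix w u'))
        rw [map_mul, map_neg, Complex.conj_I, neg_neg]
        linear_combination starRingEnd ℂ (M.hMatrix u w) * M.hMatrix u w * M.hMatrix w u' *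
          Complex.I_mul_I - M.hMatrix w u' * g1.conj_mul
      · rw [if_neg (by decide), if_neg (by decide), if_neg (by decide), if_neg (by decide)]
        simp
      · rw [if_pos (by decide), if_neg (by decide), if_neg (by decide), if_pos (by decide)]
        change M.hMatrix u' w' = starRingEnd ℂ (-1 * (M.hMatrix u w * M.hMatrix w u')) * 1 *
          (-1 * (M.hMatrix u w * M.hMatrix w u' * M.hMatrix u' w'))
        rw [map_mul, map_neg, map_one, map_mul]
        linear_combination -M.hMatrix u' w' * (starRingEnd ℂ (M.hMatrix w u') * M.hMatrix w u' *
          g1.conj_mul + g2.conj_mul)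
    rcases lt_trichotomy i j with hij | rfl | hij
    · exact fwd i j hij
    · have e1 := (M.restrict (SimpleGraph.cycleGraph 4) f).hMatrix_ne_zero_iff (u := i) (v := i)
      have e2 := negFourCycle.hMatrix_ne_zero_iff (u := i) (v := i)
      simp only [SimpleGraph.irrefl, iff_false, not_not] at e1 e2
      rw [e1, e2]
      simp
    · have := congrArg (starRingEnd ℂ) (fwd j i hij)
      rw [conj_hMatrix, map_mul, map_mul, Complex.conj_conj, conj_hMatrix] at this
      rw [this]
      ring
  · intro i j hij
    exact ⟨hadj i j hij, fun h => h.2, fun h => ⟨hij, h⟩⟩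

end MixedGraph

/-! ### The bipartite double -/

namespace MixedGraph

variable {V : Type*}

/-- The Hermitian adjacency matrix of the bipartite double `M × K₂`. -/
noncomputable def doubleMatrix (M : MixedGraph V) : Matrix (V × Bool) (V × Bool) ℂ :=
  Matrix.of fun x y => if x.2 = y.2 then 0 else M.hMatrix x.1 y.1

theorem doubleMatrix_apply (M : MixedGraph V) (x y : V × Bool) :
    M.doubleMatrix x y = if x.2 = y.2 then 0 else M.hMatrix x.1 y.1 := rfl

theorem doubleMatrix_ne_zero_iff (M : MixedGraph V) {x y : V × Bool} :
    M.doubleMatrix x y ≠ 0 ↔ x.2 ≠ y.2 ∧ M.graph.Adj x.1 y.1 := by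
  rw [doubleMatrix_apply, ← hMatrix_ne_zero_iff]
  split_ifs with h <;> simp [h]

theorem doubleMatrix_mulVec [Fintype V] (M : MixedGraph V) (f : V × Bool → ℂ) (u : V) (ε : Bool) :
    (M.doubleMatrix *ᵥ f) (u, ε) = (M.hMatrix *ᵥ fun v => f (v, !ε)) u := by
  simp only [Matrix.mulVec, dotProduct, doubleMatrix_apply, Fintype.sum_prod_type,
    Fintype.sum_bool]
  refine sum_congr rfl fun v _ => ?_
  cases ε <;> simp

theorem admissibleGain_doubleMatrix [Fintype V] [DecidableEq V] {M : MixedGraph V}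
    (hM : IsFree negFourCycle M) (hr : M.spectralRadius ≤ √(2 + √5)) :
    AdmissibleGain M.doubleMatrix Prod.snd where
  conj_apply x y := by
    rw [doubleMatrix_apply, doubleMatrix_apply, apply_ite (starRingEnd ℂ), map_zero, conj_hMatrix]
    simp only [eq_comm]
  isGaussUnit {x y} h := by
    rw [doubleMatrix_apply] at h ⊢
    split_ifs at h ⊢
    · exact absurd rfl h
    · exact M.isGaussUnit_hMatrix h
  col_ne h := (M.doubleMatrix_ne_zero_iff.1 h).1
  four_cycle_ne {x x' y y'} hx hy h := by
    have hne : M.doubleMatrix x y * M.doubleMatrix y x' * M.doubleMatrix x' y' *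
        M.doubleMatrix y' x ≠ 0 := by
      rw [h]
      norm_num
    simp only [mul_ne_zero_iff, doubleMatrix_ne_zero_iff] at hne
    obtain ⟨⟨⟨h1, h2⟩, h3⟩, h4⟩ := hne
    simp only [doubleMatrix_apply, if_neg h1.1, if_neg h2.1, if_neg h3.1, if_neg h4.1] at h
    refine hM.weight_ne (fun h' => hx (Prod.ext h' ?_)) (fun h' => hy (Prod.ext h' ?_)) h
    · have := h1.1
      have := h2.1
      revert h1 h2
      cases x.2 <;> cases y.2 <;> cases x'.2 <;> simp
    · have := h2.1
      have := h3.1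
      revert h2 h3
      cases y.2 <;> cases x'.2 <;> cases y'.2 <;> simp
  norm_le f := by
    have h1 : ∀ g : V → ℂ, ∑ u, Complex.normSq ((M.hMatrix *ᵥ g) u) ≤
        (2 + √5) * ∑ u, Complex.normSq (g u) := by
      intro g
      refine (M.normSq_mulVec_le g).trans (mul_le_mul_of_nonneg_right ?_
        (sum_nonneg fun u _ => Complex.normSq_nonneg _))
      rw [← Real.sq_sqrt (show 0 ≤ 2 + √5 by positivity)]
      exact pow_le_pow_left₀ M.spectralRadius_nonneg hr 2
    rw [Fintype.sum_prod_type_right, Fintype.sum_prod_type_right]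
    simp only [Fintype.sum_bool, doubleMatrix_mulVec]
    have h2 := h1 fun v => f (v, !true)
    have h3 := h1 fun v => f (v, !false)
    simp only [Bool.not_true, Bool.not_false] at h2 h3 ⊢
    linarith

theorem inCore_doubleMatrix (M : MixedGraph V) {S : Set V}
    (hS : ∀ w ∈ S, ∃ a ∈ S, ∃ b ∈ S, a ≠ b ∧ M.graph.Adj w a ∧ M.graph.Adj w b) {w : V}
    (hw : w ∈ S) (ε : Bool) : InCore M.doubleMatrix (w, ε) := by
  refine ⟨{x | x.1 ∈ S}, hw, ?_⟩
  rintro ⟨u, δ⟩ hu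
  obtain ⟨a, ha, b, hb, hab, h1, h2⟩ := hS u hu
  refine ⟨(a, !δ), ha, (b, !δ), hb, by simpa using hab, ?_, ?_⟩ <;>
    rw [doubleMatrix_ne_zero_iff] <;> simpa

/-- If a component of the bipartite double is, up to switching, `mStar` or `mStar` minus a vertex
of degree `2`, then `M` is bipartite, because the colour classes of that component have different
sizes, and hence `M` is isomorphic to the component. -/
theorem isSwitchingInduced_of_isMStarCopy {M : MixedGraph V}
    (hM : M.graph.Connected) {A : Finset (Fin 10)} {s : Fin 10 → V × Bool} {D : Fin 10 → ℂ}
    [Fintype V] (h : IsMStarCopy M.doubleMatrix Prod.snd A s D) : M.IsSwitchingInduced mStar := by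
  classical
  have cl : ∀ {u w : V} {ε : Bool}, (∃ i ∈ A, s i = (u, ε)) → M.graph.Adj u w →
      ∃ i ∈ A, s i = (w, !ε) := by
    rintro u w ε ⟨i, hi, hs⟩ hadj
    refine h.closed i hi (w, !ε) ?_
    rw [hs, doubleMatrix_ne_zero_iff]
    simpa using hadj
  have h0 : (0 : Fin 10) ∈ A := h.mem 0 (by decide)
  -- no vertex of `M` has both its copies in the component
  have sep : ∀ u, ¬ ((∃ i ∈ A, s i = (u, true)) ∧ ∃ i ∈ A, s i = (u, false)) := by
    intro u hu
    have all := hM.mem_of_closed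
      (T := {u | (∃ i ∈ A, s i = (u, true)) ∧ ∃ i ∈ A, s i = (u, false)})
      (fun x hx y hxy => ⟨cl hx.2 hxy, cl hx.1 hxy⟩) hu
    have all' : ∀ (u : V) (ε : Bool), ∃ i ∈ A, s i = (u, ε) := by
      intro u ε
      cases ε
      exacts [(all u).2, (all u).1]
    have card : ∀ ε, (A.filter fun i => (s i).2 = ε).card = Fintype.card V := by
      intro ε
      rw [← card_univ]
      refine card_bij (fun i _ => (s i).1) (fun _ _ => mem_univ _) ?_ ?_
      · intro i hi j hj hij
        rw [mem_filter] at hi hj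
        exact h.injOn i hi.1 j hj.1 (Prod.ext hij (hi.2.trans hj.2.symm))
      · intro u _
        obtain ⟨i, hi, hs⟩ := all' u ε
        exact ⟨i, by simp [hi, hs], by simp [hs]⟩
    have c1 := (card (s 0).2).trans (card (!(s 0).2)).symm
    have c2 : A.filter (fun i => (s i).2 = (s 0).2) ⊆ univ.filter fun i => i < 4 := by
      intro i hi
      rw [mem_filter] at hi
      simpa using (h.col i hi.1).1 hi.2
    have c3 : (univ.filter fun i : Fin 10 => 4 ≤ i ∧ i ≠ 9) ⊆
        A.filter (fun i => (s i).2 = !(s 0).2) := by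
      intro i hi
      simp only [mem_filter, mem_univ, true_and] at hi
      have hiA := h.mem i hi.2
      have := (h.col i hiA).not.2 (not_lt.2 hi.1)
      rw [mem_filter]
      refine ⟨hiA, ?_⟩
      revert this
      cases (s i).2 <;> cases (s 0).2 <;> simp
    have c4 := card_le_card c2
    have c5 := card_le_card c3
    have c6 : (univ.filter fun i : Fin 10 => i < 4).card = 4 := by decide
    have c7 : (univ.filter fun i : Fin 10 => 4 ≤ i ∧ i ≠ 9).card = 5 := by decide
    omega
  have surj : ∀ u, ∃ i ∈ A, (s i).1 = u := by
    refine hM.mem_of_closed (T := {u | ∃ i ∈ A, (s i).1 = u}) ?_ (u := (s 0).1) ⟨0, h0, rfl⟩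
    rintro _ ⟨i, hi, rfl⟩ y hy
    obtain ⟨j, hj, hs⟩ := cl ⟨i, hi, rfl⟩ hy
    exact ⟨j, hj, by rw [hs]⟩
  choose g hgA hg using surj
  have ginj : Function.Injective g := fun u v huv => by rw [← hg u, ← hg v, huv]
  have hmat : ∀ u v, M.hMatrix u v = M.doubleMatrix (s (g u)) (s (g v)) := by
    intro u v
    rw [doubleMatrix_apply, hg, hg]
    split_ifs with hc
    · by_contra hne
      have hadj := M.hMatrix_ne_zero_iff.1 hne
      have e1 : s (g u) = (u, (s (g u)).2) := Prod.ext (hg u) rfl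
      have e2 : s (g v) = (v, (s (g u)).2) := Prod.ext (hg v) hc.symm
      have e3 := cl ⟨g u, hgA u, e1⟩ hadj
      have e4 : ∃ i ∈ A, s i = (v, (s (g u)).2) := ⟨g v, hgA v, e2⟩
      refine sep v ?_
      revert e3 e4
      cases (s (g u)).2
      · exact fun a b => ⟨a, b⟩
      · exact fun a b => ⟨b, a⟩
    · rfl
  let N : MixedGraph V :=
    { graph := mStar.graph.comap g
      Arc := fun u v => mStar.Arc (g u) (g v)
      adj_of_arc := fun h => mStar.adj_of_arc h
      arc_asymm := fun h => mStar.arc_asymm h }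
  refine ⟨N, ⟨Equiv.refl V, Or.inl ⟨fun u => D (g u), fun u => h.unit _ (hgA u), ?_⟩⟩,
    ⟨g, ginj⟩, fun u v => ⟨Iff.rfl, Iff.rfl⟩⟩
  intro u v
  rw [inv_eq_of_mul_eq_one_right (h.unit _ (hgA u)).mul_conj, hmat, h.apply _ (hgA u) _ (hgA v)]
  rfl

/-! ### The mixed graph `mStar` -/

theorem mStar_mulVec (f : Fin 10 → ℂ) :
    mStar.hMatrix *ᵥ f = ![Complex.I * (f 4 + f 5 + f 6), Complex.I * (f 7 + f 8 - f 4),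
      Complex.I * (f 9 - f 5 - f 7), -Complex.I * (f 6 + f 8 + f 9), Complex.I * (f 1 - f 0),
      Complex.I * (f 2 - f 0), Complex.I * (f 3 - f 0), Complex.I * (f 2 - f 1),
      Complex.I * (f 3 - f 1), Complex.I * (f 3 - f 2)] := by
  ext i
  simp only [Matrix.mulVec, dotProduct, Fin.sum_univ_succ, mStar_hMatrix_apply, mStarArcs]
  fin_cases i <;> simp <;> ring

/-- `4 - H(mStar) ^ 2` is a sum of squares: on the vertices of `K₄` it is the square of the sum, on
the subdivision vertices it is the sum of the squares over the triangles of `K₄`. -/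
theorem normSq_mStar_mulVec_le (f : Fin 10 → ℂ) :
    ∑ u, Complex.normSq ((mStar.hMatrix *ᵥ f) u) ≤ 2 ^ 2 * ∑ u, Complex.normSq (f u) := by
  have key : ∑ u, Complex.normSq ((mStar.hMatrix *ᵥ f) u) +
      (Complex.normSq (f 0 + f 1 + f 2 + f 3) + Complex.normSq (f 4 + f 7 - f 5) +
        Complex.normSq (f 4 + f 8 - f 6) + Complex.normSq (f 5 + f 9 - f 6) +
        Complex.normSq (f 7 + f 9 - f 8)) = 2 ^ 2 * ∑ u, Complex.normSq (f u) := by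
    rw [mStar_mulVec]
    simp [Fin.sum_univ_succ, Complex.normSq_apply]
    ring
  have h := Complex.normSq_nonneg
  linarith [h (f 0 + f 1 + f 2 + f 3), h (f 4 + f 7 - f 5), h (f 4 + f 8 - f 6),
    h (f 5 + f 9 - f 6), h (f 7 + f 9 - f 8)]

theorem spectralRadius_mStar : mStar.spectralRadius = 2 := by
  refine le_antisymm (mStar.spectralRadius_le (by norm_num) normSq_mStar_mulVec_le) ?_
  have h := mStar.normSq_mulVec_le ![1, -1, 0, 0, 0, 0, 0, 0, 0, 0]
  rw [mStar_mulVec] at h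
  simp [Fin.sum_univ_succ, Complex.normSq_apply] at h
  norm_num at h
  nlinarith [mStar.spectralRadius_nonneg]

/-- Interlacing, for induced subgraphs up to switching isomorphism. -/
theorem IsSwitchingInduced.spectralRadius_le [Fintype V] [DecidableEq V] {W : Type*} [Fintype W]
    {M : MixedGraph V} {N : MixedGraph W} (h : M.IsSwitchingInduced N) {c : ℝ} (hc : 0 ≤ c)
    (hN : ∀ f : W → ℂ, ∑ u, Complex.normSq ((N.hMatrix *ᵥ f) u) ≤
      c ^ 2 * ∑ u, Complex.normSq (f u)) : M.spectralRadius ≤ c := by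
  classical
  -- a matrix `D⁻¹ B D` with `B` a principal submatrix of a matrix within the bound
  have aux : ∀ (B : Matrix W W ℂ), (∀ f : W → ℂ, ∑ u, Complex.normSq ((B *ᵥ f) u) ≤
      c ^ 2 * ∑ u, Complex.normSq (f u)) → ∀ (g : V → W), Function.Injective g →
      ∀ d : V → ℂ, (∀ v, IsGaussUnit (d v)) →
      (∀ u v, M.hMatrix u v = (d u)⁻¹ * B (g u) (g v) * d v) → M.spectralRadius ≤ c := by
    intro B hB g hg d hd hM
    refine M.spectralRadius_le hc fun f => ?_
    set f' : W → ℂ := fun w => ∑ v, if g v = w then d v * f v else 0 with hf'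
    have h1 : ∀ v, f' (g v) = d v * f v := by
      intro v
      simp [hf', hg.eq_iff]
    have h2 : ∀ w, w ∉ univ.image g → f' w = 0 := by
      intro w hw
      refine sum_eq_zero fun v _ => if_neg ?_
      rintro rfl
      exact hw (mem_image_of_mem _ (mem_univ _))
    have h3 : ∑ w, Complex.normSq (f' w) = ∑ v, Complex.normSq (f v) := by
      rw [← sum_subset (subset_univ (univ.image g)) fun w _ hw => by rw [h2 w hw, map_zero],
        sum_image fun i _ j _ h => hg h]
      exact sum_congr rfl fun v _ => by rw [h1, map_mul, (hd v).normSq, one_mul]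
    have h4 : ∀ u, (M.hMatrix *ᵥ f) u = (d u)⁻¹ * (B *ᵥ f') (g u) := by
      intro u
      simp only [Matrix.mulVec, dotProduct]
      rw [← sum_subset (subset_univ (univ.image g)) fun w _ hw => by rw [h2 w hw, mul_zero],
        sum_image fun i _ j _ h => hg h, mul_sum]
      exact sum_congr rfl fun v _ => by rw [h1, hM]; ring
    rw [← h3]
    refine le_trans ?_ (hB f')
    have h5 : ∀ u, Complex.normSq ((M.hMatrix *ᵥ f) u) = Complex.normSq ((B *ᵥ f') (g u)) := by
      intro u
      rw [h4, map_mul, Complex.normSq_inv, (hd u).normSq, inv_one, one_mul]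
    simp only [h5]
    rw [← sum_image (f := fun w => Complex.normSq ((B *ᵥ f') w)) fun i _ j _ h => hg h]
    exact sum_le_sum_of_subset_of_nonneg (subset_univ _) fun _ _ _ => Complex.normSq_nonneg _
  obtain ⟨N', ⟨σ, hσ⟩, e, he⟩ := h
  have hN' : ∀ u v, N'.hMatrix u v = N.hMatrix (e u) (e v) := by
    intro u v
    simp only [hMatrix, Matrix.of_apply, (he u v).1, (he u v).2, (he v u).2]
  have hinj : Function.Injective fun v => e (σ v) := e.injective.comp σ.injective
  rcases hσ with ⟨d, hd, hM⟩ | ⟨d, hd, hM⟩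
  · refine aux N.hMatrix hN _ hinj d hd fun u v => ?_
    rw [hM, ← hN']
    rfl
  · refine aux (N.hMatrix.map (starRingEnd ℂ)) (fun f => ?_) _ hinj d hd fun u v => ?_
    · have := hN fun w => starRingEnd ℂ (f w)
      have h6 : ∀ w, (N.hMatrix *ᵥ fun w => starRingEnd ℂ (f w)) w =
          starRingEnd ℂ ((N.hMatrix.map (starRingEnd ℂ) *ᵥ f) w) := by
        intro w
        simp [Matrix.mulVec, dotProduct]
      simpa only [h6, Complex.normSq_conj] using this
    · rw [hM, Matrix.map_apply, ← hN', conj_hMatrix]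
      have : (N'.converse.relabel σ).hMatrix u v = N'.hMatrix (σ v) (σ u) := by
        simp only [hMatrix, Matrix.of_apply, relabel, converse, SimpleGraph.comap_adj,
          N'.graph.adj_comm]
      rw [this]

end MixedGraph

theorem mainTheorem4 :
    MixedGraph.mStar.spectralRadius = 2 ∧
    ∀ (V : Type*) [Fintype V] [DecidableEq V] (M : MixedGraph V),
      M.graph.Connected → MixedGraph.IsFree MixedGraph.negFourCycle M → M.HasTwoCycles →
      (√(2 + √5) < M.spectralRadius ↔ ¬ M.IsSwitchingInduced MixedGraph.mStar) := by
  refine ⟨MixedGraph.spectralRadius_mStar, fun V _ _ M hconn hfree htwo => ⟨fun h hind => ?_, ?_⟩⟩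
  · have h1 := hind.spectralRadius_le (by norm_num) MixedGraph.normSq_mStar_mulVec_le
    have h2 : 2 ≤ √(2 + √5) := Real.le_sqrt_of_sq_le (by linarith [sqrt_five_bounds.1])
    linarith
  · intro hind
    by_contra! hr
    have hH := MixedGraph.admissibleGain_doubleMatrix hfree hr
    obtain ⟨u, v, p, q, hp, hq, hpq⟩ := htwo
    obtain ⟨S, hS, w, -, a, ha, b, hb, c, hc, hab, hac, hbc, wa, wb, wc⟩ :=
      hconn.exists_branch hp hq hpq
    have adj : ∀ {x}, M.graph.Adj w x → M.doubleMatrix (w, false) (x, true) ≠ 0 := by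
      intro x hx
      rw [MixedGraph.doubleMatrix_ne_zero_iff]
      simpa using hx
    obtain ⟨A, s, D, h⟩ := hH.exists_isMStarCopy (v := (w, false)) (a := (a, true))
      (b := (b, true)) (c := (c, true)) (by simpa using hab) (by simpa using hac)
      (by simpa using hbc) (adj wa) (adj wb) (adj wc) (M.inCore_doubleMatrix hS ha true)
      (M.inCore_doubleMatrix hS hb true) (M.inCore_doubleMatrix hS hc true)
    exact hind (MixedGraph.isSwitchingInduced_of_isMStarCopy hconn h)
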